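/- Let $c\ge 0$ and $\kappa\in\mathbb R$, and consider the equation $$icu'+u''+u(1-|u|^2)+\kappa u(1-|u|^2)''=0\quad\text{on }\mathbb R,\qquad (\mathrm{TW}(c,\kappa))$$ for $u:\mathbb R\to\mathbb C$. Let $\mathcal X(\mathbb R)=\{v\in H^1_{\rm loc}(\mathbb R;\mathbb C): 1-|v|^2\in L^2(\mathbb R),\ v'\in L^2(\mathbb R)\}$. Put $$\mathcal D_1=\{0\le c<\sqrt2,\ 0<\kappa<\tfrac12\},\quad \mathcal D_2=\{0\le c<\sqrt2,\ \kappa\le 0\},\quad \mathcal D_3=\{c>\sqrt2,\ \kappa>\tfrac12\},$$ $\mathcal D=\mathcal D_1\cup\mathcal D_2\cup\mathcal D_3$. Let $\mathcal I_c=(0,1-c^2/2]$ if $c<\sqrt2$ and $\mathcal J_c=[1-c^2/2,0)$ if $c>\sqrt 2$. With $$r(y)=\frac{2-c^2-2y}{1-2\kappa+2\kappa y},\qquad m(y)=2\sqrt{\tfrac{1-2\kappa}{2-c^2}}\ \mathrm{atanh}\Big(\sqrt{\tfrac{1-2\kappa}{2-c^2}\,r(y)}\Big),$$ define $F_{c,\kappa}(y)=2\sqrt{\kappa}\,\mathrm{atan}\big(\sqrt{\kappa\,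 r(y)}\big)+m(y)$ on $\mathcal I_c$ for $(c,\kappa)\in\mathcal D_1$; $G_{c,\kappa}(y)=-2\sqrt{-\kappa}\,\mathrm{atanh}\big(\sqrt{-\kappa\, r(y)}\big)+m(y)$ on $\mathcal I_c$ for $(c,\kappa)\in\mathcal D_2$; and $H_{c,\kappa}$ by the same formula as $F_{c,\kappa}$, on $\mathcal J_c$, for $(c,\kappa)\in\mathcal D_3$. 1. If $(c,\kappa)\notin\mathcal D$ and $u\in\mathcal X(\mathbb R)\cap\mathcal C^2(\mathbb R)$ solves $(\mathrm{TW}(c,\kappa))$, then there is $\phi\in\mathbb R$ with $u(x)=e^{i\phi}$ for all $x\in\mathbb R$. 2. Let $(c,\kappa)\in\mathcal D$. Then $F_{c,\kappa}$, $G_{c,\kappa}$, $H_{c,\kappa}$, respectively, is a bijection from its interval onto $[0,\infty)$. Let $\eta_{c,\kappa}:\mathbb R\to\mathbb R$ be the even function that equals $F_{c,\kappa}^{-1}$ if $(c,\kappa)\in\mathcal D_1$, $G_{c,\kappa}^{-1}$ if $(c,\kappa)\in\mathcal D_2$, and $H_{c,\kappa}^{-1}$ if $(c,\kappa)\in\mathcal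 D_3$, on $[0,\infty)$. - If $c>0$, then $\eta_{c,\kappa}<1$ on $\mathbb R$, and $$u_{c,\kappa}(x)=\sqrt{1-\eta_{c,\kappa}(x)}\,e^{i\theta_{c,\kappa}(x)},\qquad \theta_{c,\kappa}(x)=\frac c2\int_0^x\frac{\eta_{c,\kappa}(y)}{1-\eta_{c,\kappa}(y)}\,dy,$$ is, up to translation and multiplication by a constant phase, the unique solution of $(\mathrm{TW}(c,\kappa))$ in $\mathcal C^2(\mathbb R)\cap\mathcal X(\mathbb R)$ that is not a constant of modulus one. - If $c=0$, the same holds for the real-valued odd function $u_{0,\kappa}(x)=\pm\sqrt{1-\eta_{0,\kappa}(x)}$ for $\pm x\ge 0$. In addition, for every $(c,\kappa)\in\mathcal D$, $u_{c,\kappa}$ and $\eta_{c,\kappa}$ belong to $\mathcal C^\infty(\mathbb R)$, and $\eta_{c,\kappa}$ is even and has a global extremum at the origin, with $\eta_{c,\kappa}(0)=1-c^2/2$. Moreover $\eta_{c,\kappa}>0$ and $\eta_{c,\kappa}'<0$ on $(0,\infty)$ if $(c,\kappa)\in\mathcal D_1\cup\mathcal D_2$, while $\eta_{c,\kappa}<0$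 and $\eta_{c,\kappa}'>0$ on $(0,\infty)$ if $(c,\kappa)\in\mathcal D_3$. Finally, there is a constant $C>0$ such that for every integer $k\ge 0$ there is a constant $A>0$ with $$|D^k u_{c,\kappa}'(x)|+|D^k\eta_{c,\kappa}(x)|\le A e^{-C|x|}\qquad\text{for all }x\in\mathbb R.$$ -/

import Mathlib

namespace QGP

noncomputable section

/-! ### Finite energy travelling waves -/

/-- `w` is a weak (distributional) derivative of `v` on the real line. -/
def IsWeakDeriv (v w : ℝ → ℂ) : Prop :=
  ∀ φ : ℝ → ℝ, ContDiff ℝ (⊤ : ℕ∞) φ → HasCompactSupport φ →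
    ∫ x, deriv φ x • v x = -∫ x, φ x • w x

/-- The energy space `{v ∈ H¹_loc(ℝ) : 1 - |v|² ∈ L²(ℝ), v' ∈ L²(ℝ)}`. Membership in `H¹_loc`
means that `v` is in `L²` on compact sets and has a weak derivative in `L²` on compact sets;
the last requirement is contained in `v' ∈ L²(ℝ)`. -/
def energySpace : Set (ℝ → ℂ) :=
  {v | (∀ K : Set ℝ, IsCompact K → MeasureTheory.MemLp v 2 (MeasureTheory.volume.restrict K)) ∧
    MeasureTheory.MemLp (fun x => 1 - ‖v x‖ ^ 2) 2 MeasureTheory.volume ∧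
    ∃ w : ℝ → ℂ, IsWeakDeriv v w ∧ MeasureTheory.MemLp w 2 MeasureTheory.volume}

/-- The travelling wave equation
`i c u' + u'' + u (1 - |u|²) + κ u (1 - |u|²)'' = 0` on `ℝ`. -/
def TWEquation (c κ : ℝ) (u : ℝ → ℂ) : Prop :=
  ∀ x : ℝ, Complex.I * (c : ℂ) * deriv u x + deriv (deriv u) x
    + u x * ((1 - ‖u x‖ ^ 2 : ℝ) : ℂ)
    + (κ : ℂ) * u x * ((deriv (deriv (fun y : ℝ => 1 - ‖u y‖ ^ 2)) x : ℝ) : ℂ) = 0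

/-- `u` is a solution of the travelling wave equation in `𝒞²(ℝ) ∩ 𝒳(ℝ)`. -/
def IsSmoothSol (c κ : ℝ) (u : ℝ → ℂ) : Prop :=
  ContDiff ℝ 2 u ∧ u ∈ energySpace ∧ TWEquation c κ u

/-- `u` is a constant of modulus one. -/
def IsTrivial (u : ℝ → ℂ) : Prop :=
  ∃ φ : ℝ, ∀ x : ℝ, u x = Complex.exp ((φ : ℂ) * Complex.I)

/-- `u` is, up to translation and phase shift, the unique nontrivial solution of the travelling
wave equation in `𝒞²(ℝ) ∩ 𝒳(ℝ)`. -/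
def IsUniqueNontrivialSol (c κ : ℝ) (u : ℝ → ℂ) : Prop :=
  IsSmoothSol c κ u ∧ ¬ IsTrivial u ∧
    ∀ v : ℝ → ℂ, IsSmoothSol c κ v → ¬ IsTrivial v →
      ∃ x₀ φ : ℝ, ∀ x : ℝ, v x = Complex.exp ((φ : ℂ) * Complex.I) * u (x - x₀)

/-! ### Regions of parameters -/

def D₁ : Set (ℝ × ℝ) := {p | 0 ≤ p.1 ∧ p.1 < √2 ∧ 0 < p.2 ∧ p.2 < 1 / 2}

def D₂ : Set (ℝ × ℝ) := {p | 0 ≤ p.1 ∧ p.1 < √2 ∧ p.2 ≤ 0}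

def D₃ : Set (ℝ × ℝ) := {p | √2 < p.1 ∧ 1 / 2 < p.2}

def D : Set (ℝ × ℝ) := D₁ ∪ D₂ ∪ D₃

/-! ### Explicit solitons -/

/-- The interval `(0, 1 - c²/2]`. -/
def intervalI (c : ℝ) : Set ℝ := Set.Ioc 0 (1 - c ^ 2 / 2)

/-- The interval `[1 - c²/2, 0)`. -/
def intervalJ (c : ℝ) : Set ℝ := Set.Ico (1 - c ^ 2 / 2) 0

/-- The function `F_{c,κ}`. -/
def funF (c κ y : ℝ) : ℝ :=
  2 * √κ * Real.arctan (√κ * √((2 - c ^ 2 - 2 * y) / (1 - 2 * κ + 2 * κ * y)))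
    + 2 * √((1 - 2 * κ) / (2 - c ^ 2)) *
      Real.artanh (√(((1 - 2 * κ) * (2 - c ^ 2 - 2 * y)) /
        ((2 - c ^ 2) * (1 - 2 * κ + 2 * κ * y))))

/-- The function `G_{c,κ}`. -/
def funG (c κ y : ℝ) : ℝ :=
  -2 * √(-κ) * Real.artanh (√(-κ) * √((2 - c ^ 2 - 2 * y) / (1 - 2 * κ + 2 * κ * y)))
    + 2 * √((1 - 2 * κ) / (2 - c ^ 2)) *
      Real.artanh (√(((1 - 2 * κ) * (2 - c ^ 2 - 2 * y)) /
        ((2 - c ^ 2) * (1 - 2 * κ + 2 * κ * y))))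

/-- The function `H_{c,κ}`, given by the same formula as `F_{c,κ}` (but considered on the interval
`[1 - c²/2, 0)`). -/
def funH (c κ y : ℝ) : ℝ := funF c κ y

/-- The even extension to `ℝ` of the inverse of the restriction of `g` to `s`. -/
def evenInverse (g : ℝ → ℝ) (s : Set ℝ) (x : ℝ) : ℝ := Function.invFunOn g s |x|

open scoped Classical in
/-- The intensity profile `η_{c,κ}`; it is only meaningful for `(c, κ) ∈ D`. -/
def eta (c κ : ℝ) : ℝ → ℝ :=
  if (c, κ) ∈ D₁ then evenInverse (funF c κ) (intervalI c)
  else if (c, κ) ∈ D₂ then evenInverse (funG c κ) (intervalI c)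
  else evenInverse (funH c κ) (intervalJ c)

/-- The phase `θ_{c,κ}`. -/
def theta (c κ x : ℝ) : ℝ := c / 2 * ∫ y in (0 : ℝ)..x, eta c κ y / (1 - eta c κ y)

/-- The soliton `√(1 - η) e^{iθ}` for `c > 0`. -/
def solitonPos (c κ x : ℝ) : ℂ :=
  ((√(1 - eta c κ x) : ℝ) : ℂ) * Complex.exp ((theta c κ x : ℂ) * Complex.I)

/-- The black soliton `±√(1 - η_{0,κ}(x))` for `±x ≥ 0`. -/
def blackSoliton (κ x : ℝ) : ℂ :=
  if 0 ≤ x then ((√(1 - eta 0 κ x) : ℝ) : ℂ) else ((-√(1 - eta 0 κ x) : ℝ) : ℂ)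

/-- The soliton `u_{c,κ}`. -/
def soliton (c κ : ℝ) : ℝ → ℂ :=
  if c = 0 then blackSoliton κ else solitonPos c κ

end

end QGP

/-
Write `η = 1 - |u|²`. Pairing the equation with `i u` and with `u'` gives two first integrals whose
constants vanish because the energy is finite: the momentum density is `(c / 2) η`, and
`|u'|² = η² / 2 + κ η'² / 2`. Combining them, `η` is a solution tending to zero of
`(1 - 2κ + 2κη) η'² = η² (2 - c² - 2η)`. A nonzero one attains the value `1 - c² / 2` at its
extremum and then falls back to zero at the speed this equation prescribes; this forces
`(c, κ) ∈ D` and makes `η` a translate of the even profile obtained by separation of variables,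
whose time map is `F`, `G` or `H`. Changing the sign of `η`, of `1 - 2κ` and of `1 - c² / 2` turns
negative `η` into positive `η`.

At a point where `u ≠ 0`, the values of `η`, `η'` and the momentum density determine `u` and `u'` up
to a common phase; once `η` is known the equation is a linear second-order one for `u`, which gives
uniqueness. For existence, a function of modulus `√(1 - η)` and momentum density `(c / 2) η`
satisfies the equation multiplied by the conjugate of `u`, hence the equation wherever `u ≠ 0`. For
`c > 0` this is everywhere; for `c = 0` the only zero is the origin, where the change of sign makes
the function smooth, and the equation extends there by continuity.
-/

namespace QGP

noncomputable section

open Real Set Filter Topology MeasureTheory Asymptotics ComplexConjugate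

/-! ### Calculus on the real line -/

section Calculus

variable {E : Type*} [NormedAddCommGroup E] [NormedSpace ℝ E]

theorem hasDerivAt_artanh {t : ℝ} (ht : t ∈ Ioo (-1) 1) :
    HasDerivAt artanh (1 / (1 - t ^ 2)) t := by
  have add_ne : 1 + t ≠ 0 := by linarith [ht.1]
  have sub_ne : 1 - t ≠ 0 := by linarith [ht.2]
  have sq_ne : 1 - t ^ 2 ≠ 0 := by
    rw [show 1 - t ^ 2 = (1 + t) * (1 - t) by ring]
    exact mul_ne_zero add_ne sub_ne
  have half_log : artanh =ᶠ[𝓝 t] fun x ↦ 1 / 2 * (log (1 + x) - log (1 - x)) := by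
    filter_upwards [Ioo_mem_nhds ht.1 ht.2] with x hx
    rw [artanh_eq_half_log ⟨hx.1.le, hx.2.le⟩,
      log_div (by linarith [hx.1]) (by linarith [hx.2])]
  have deriv_half_log : HasDerivAt (fun x ↦ 1 / 2 * (log (1 + x) - log (1 - x)))
      (1 / 2 * (1 / (1 + t) - -1 / (1 - t))) t :=
    ((((hasDerivAt_id t).const_add 1).log add_ne).sub
      (((hasDerivAt_id t).const_sub 1).log sub_ne)).const_mul _
  refine (deriv_half_log.congr_of_eventuallyEq half_log).congr_deriv ?_
  field_simp
  ring

theorem hasDerivAt_of_contDiff_two {f : ℝ → E} (hf : ContDiff ℝ 2 f) (x : ℝ) :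
    HasDerivAt f (deriv f x) x :=
  (hf.differentiable two_ne_zero x).hasDerivAt

theorem contDiff_one_deriv {f : ℝ → E} (hf : ContDiff ℝ 2 f) : ContDiff ℝ 1 (deriv f) :=
  (contDiff_succ_iff_deriv (n := 1).1 (by simpa [one_add_one_eq_two] using hf)).2.2

theorem hasDerivAt_deriv_of_contDiff_two {f : ℝ → E} (hf : ContDiff ℝ 2 f) (x : ℝ) :
    HasDerivAt (deriv f) (deriv (deriv f) x) x :=
  ((contDiff_one_deriv hf).differentiable one_ne_zero x).hasDerivAt

theorem contDiff_two_of_hasDerivAt {f f' : ℝ → E} (hf : ∀ x, HasDerivAt f (f' x) x)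
    (hf' : ContDiff ℝ 1 f') : ContDiff ℝ 2 f := by
  have hderiv : deriv f = f' := funext fun x ↦ (hf x).deriv
  rw [← one_add_one_eq_two, contDiff_succ_iff_deriv, hderiv]
  exact ⟨fun x ↦ (hf x).differentiableAt, by simp, hf'⟩

theorem hasDerivAt_of_parity {ε : ℝ} {f f' : ℝ → E} (hf : ∀ x, f (-x) = ε • f x)
    (hf' : ∀ x, f' (-x) = -(ε • f' x)) (hf₀ : ContinuousAt f 0) (hf'₀ : ContinuousAt f' 0)
    (h : ∀ x, 0 < x → HasDerivAt f (f' x) x) (x : ℝ) : HasDerivAt f (f' x) x := by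
  refine hasDerivAt_of_hasDerivAt_of_ne' (fun y hy ↦ ?_) hf₀ hf'₀ x
  rcases hy.lt_or_gt with hneg | hpos
  · have hy' : HasDerivAt f (f' (-y)) (-y) := h (-y) (neg_pos.2 hneg)
    have reflected := (hy'.scomp y (hasDerivAt_neg y)).const_smul ε
    have hff : f = ε • f ∘ Neg.neg := by
      ext z
      simpa using hf (-z)
    have hff' : f' y = ε • (-1 : ℝ) • f' (-y) := by
      simpa using hf' (-y)
    rw [hff, hff']
    exact reflected
  · exact h y hpos

theorem eq_of_hasDerivAt_hasDerivAt {a : ℝ → E × E → E} {s : Set (E × E)} {K : ℝ → NNReal}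
    (hK : Continuous K) (ha : ∀ t, LipschitzOnWith (K t) (a t) s) {f f' g g' : ℝ → E}
    (hf : ∀ t, HasDerivAt f (f' t) t) (hf' : ∀ t, HasDerivAt f' (a t (f t, f' t)) t)
    (hfs : ∀ t, (f t, f' t) ∈ s)
    (hg : ∀ t, HasDerivAt g (g' t) t) (hg' : ∀ t, HasDerivAt g' (a t (g t, g' t)) t)
    (hgs : ∀ t, (g t, g' t) ∈ s)
    {t₀ : ℝ} (h₀ : f t₀ = g t₀) (h₀' : f' t₀ = g' t₀) : f = g := by
  ext t
  obtain ⟨A, B, ht, ht₀⟩ : ∃ A B, t ∈ Ioo A B ∧ t₀ ∈ Ioo A B :=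
    ⟨min t t₀ - 1, max t t₀ + 1, by grind, by grind⟩
  obtain ⟨L, hL⟩ := isCompact_Icc.bddAbove_image (hK.continuousOn (s := Icc A B))
  have lipschitz (r : ℝ) (hr : r ∈ Ioo A B) :
      LipschitzOnWith (max 1 L) (fun p : E × E ↦ (p.2, a r p)) s :=
    LipschitzWith.prod_snd.lipschitzOnWith.prodMk
      ((ha r).weaken (hL (mem_image_of_mem K (Ioo_subset_Icc_self hr))))
  exact congrArg Prod.fst <| ODE_solution_unique_of_mem_Ioo lipschitz ht₀
    (fun r _ ↦ ⟨(hf r).prodMk (hf' r), hfs r⟩) (fun r _ ↦ ⟨(hg r).prodMk (hg' r), hgs r⟩)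
    (Prod.ext h₀ h₀') ht

theorem eq_zero_of_tendsto_of_tendsto_deriv {f f' : ℝ → ℝ} (hf : ∀ x, HasDerivAt f (f' x) x)
    {a b : ℝ} (ha : Tendsto f atTop (𝓝 a)) (hb : Tendsto f' atTop (𝓝 b)) : b = 0 := by
  have mean_value (x : ℝ) : ∃ ξ ∈ Ioo x (x + 1), f' ξ = (f (x + 1) - f x) / (x + 1 - x) :=
    exists_hasDerivAt_eq_slope f f' (lt_add_one x) (HasDerivAt.continuousOn fun y _ ↦ hf y)
      fun y _ ↦ hf y
  choose ξ hξ hξ' using mean_value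
  have hξ_top : Tendsto ξ atTop atTop := tendsto_atTop_mono (fun x ↦ (hξ x).1.le) tendsto_id
  have increment : Tendsto (fun x ↦ f (x + 1) - f x) atTop (𝓝 0) := by
    simpa using (ha.comp (tendsto_atTop_add_const_right _ 1 tendsto_id)).sub ha
  refine tendsto_nhds_unique (hb.comp hξ_top) (increment.congr fun x ↦ ?_)
  simp [hξ' x]

theorem eq_zero_of_hasDerivAt_zero_of_memLp {f : ℝ → E} {p : ENNReal} (hp₀ : p ≠ 0)
    (hp : p ≠ ⊤) (hf : ∀ x, HasDerivAt f 0 x) (hfp : MemLp f p) (x : ℝ) : f x = 0 := by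
  have hconst : f = fun _ ↦ f x := funext fun y ↦
    is_const_of_deriv_eq_zero (fun z ↦ (hf z).differentiableAt) (fun z ↦ (hf z).deriv) y x
  rw [hconst, memLp_const_iff hp₀ hp] at hfp
  simpa using hfp

theorem tendsto_zero_of_memLp_two {f f' : ℝ → ℝ} (hf : ∀ x, HasDerivAt f (f' x) x)
    (hf₂ : MemLp f 2) (hf'₂ : MemLp f' 2) : Tendsto f (cocompact ℝ) (𝓝 0) := by
  have hderiv (x : ℝ) : HasDerivAt (fun x ↦ f x ^ 2) (2 * f x * f' x) x := by
    simpa using (hf x).fun_pow 2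
  have hint : Integrable fun x ↦ f x ^ 2 := hf₂.integrable_sq
  have hint' : Integrable fun x ↦ 2 * f x * f' x := by
    simpa only [mul_assoc, Pi.mul_apply] using (hf₂.integrable_mul hf'₂).const_mul 2
  have hsq : Tendsto (fun x ↦ f x ^ 2) (cocompact ℝ) (𝓝 0) := by
    rw [cocompact_eq_atBot_atTop]
    exact (tendsto_zero_of_hasDerivAt_of_integrableOn_Iic (a := 0) (fun x _ ↦ hderiv x)
      hint'.integrableOn hint.integrableOn).sup
      (tendsto_zero_of_hasDerivAt_of_integrableOn_Ioi (a := 0) (fun x _ ↦ hderiv x)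
      hint'.integrableOn hint.integrableOn)
  rw [tendsto_zero_iff_abs_tendsto_zero]
  simpa [Function.comp_def, sqrt_sq_eq_abs] using hsq.sqrt

end Calculus

/-! ### The profile of a soliton -/

/-- Parameters for which the profile equation `(p + 2κy) y'² = 2 y² (m - y)` has a positive
solution that decays at infinity and has maximum `m`: the coefficient `p + 2κy` is positive at
both ends of `[0, m]`. -/
structure Admissible (m p κ : ℝ) : Prop where
  m_pos : 0 < m
  p_pos : 0 < p
  coeff_max_pos : 0 < p + 2 * κ * m

/-- The square of the logarithmic derivative of the profile where it takes the value `y`. It is the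
`r(y)` of the theorem for `m = 1 - c²/2` and `p = 1 - 2κ`. -/
def rate (m p κ y : ℝ) : ℝ := (2 * m - 2 * y) / (p + 2 * κ * y)

/-- The speed at which the profile passes through the value `y`. -/
def speed (m p κ y : ℝ) : ℝ := y * √(rate m p κ y)

/-- The second derivative of the profile where it takes the value `y`, that is
`speed * speed'`. -/
def accel (m p κ y : ℝ) : ℝ :=
  y * rate m p κ y - y ^ 2 * (p + 2 * κ * m) / (p + 2 * κ * y) ^ 2

/-- The contribution of the quasilinear term to the time `profileTime`, as a function of the
square root of the rate. -/
def timeCorrection (κ t : ℝ) : ℝ :=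
  if 0 < κ then 2 * √κ * arctan (√κ * t) else -2 * √(-κ) * artanh (√(-κ) * t)

/-- `profileTime` as a function of the square root of the rate. -/
def timeOfSqrtRate (m p κ t : ℝ) : ℝ :=
  timeCorrection κ t + 2 * √(p / (2 * m)) * artanh (√(p / (2 * m)) * t)

/-- The time that the profile needs to go from its maximum `m` down to `y`. -/
def profileTime (m p κ y : ℝ) : ℝ := timeOfSqrtRate m p κ √(rate m p κ y)

/-- The even profile with maximum `m` at the origin. -/
def profile (m p κ : ℝ) : ℝ → ℝ := evenInverse (profileTime m p κ) (Ioc 0 m)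

/-- The derivative of the profile. -/
def profileDeriv (m p κ x : ℝ) : ℝ := -(Real.sign x * speed m p κ (profile m p κ x))

theorem rate_self (m p κ : ℝ) : rate m p κ m = 0 := by simp [rate]

theorem speed_self (m p κ : ℝ) : speed m p κ m = 0 := by simp [speed, rate_self]

theorem profileTime_self (m p κ : ℝ) : profileTime m p κ m = 0 := by
  simp [profileTime, timeOfSqrtRate, rate_self, timeCorrection]

theorem profile_neg (m p κ x : ℝ) : profile m p κ (-x) = profile m p κ x := by
  simp [profile, evenInverse]

theorem profileDeriv_neg (m p κ x : ℝ) : profileDeriv m p κ (-x) = -profileDeriv m p κ x := by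
  simp [profileDeriv, profile_neg, Real.sign_neg]

theorem profileDeriv_zero (m p κ : ℝ) : profileDeriv m p κ 0 = 0 := by simp [profileDeriv]

theorem profileDeriv_of_pos {m p κ x : ℝ} (hx : 0 < x) :
    profileDeriv m p κ x = -speed m p κ (profile m p κ x) := by
  rw [profileDeriv, Real.sign_of_pos hx, one_mul]

theorem hasDerivAt_const_mul_artanh {a t : ℝ} (ha : 0 ≤ a) (ht : 0 ≤ t) (h : a * t ^ 2 < 1) :
    HasDerivAt (fun t ↦ √a * artanh (√a * t)) (a / (1 - a * t ^ 2)) t := by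
  have hsq : (√a * t) ^ 2 = a * t ^ 2 := by rw [mul_pow, sq_sqrt ha]
  have hmem : √a * t ∈ Ioo (-1) 1 :=
    ⟨by linarith [mul_nonneg (sqrt_nonneg a) ht], by rwa [← sq_lt_one_iff₀ (by positivity), hsq]⟩
  refine (((hasDerivAt_artanh hmem).comp t
    ((hasDerivAt_id t).const_mul √a)).const_mul √a).congr_deriv ?_
  rw [hsq]
  linear_combination (1 / (1 - a * t ^ 2)) * mul_self_sqrt ha

theorem hasDerivAt_const_mul_arctan {a : ℝ} (ha : 0 ≤ a) (t : ℝ) :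
    HasDerivAt (fun t ↦ √a * arctan (√a * t)) (a / (1 + a * t ^ 2)) t := by
  refine ((((hasDerivAt_id t).const_mul √a).arctan).const_mul √a).congr_deriv ?_
  simp only [id, mul_pow, sq_sqrt ha]
  linear_combination (1 / (1 + a * t ^ 2)) * mul_self_sqrt ha

theorem hasDerivAt_timeCorrection {κ t : ℝ} (ht : 0 ≤ t) (h : 0 < 1 + κ * t ^ 2) :
    HasDerivAt (timeCorrection κ) (2 * κ / (1 + κ * t ^ 2)) t := by
  by_cases hκ : 0 < κ
  · have hfun : timeCorrection κ = fun t ↦ 2 * (√κ * arctan (√κ * t)) := by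
      ext t
      simp only [timeCorrection, if_pos hκ, mul_assoc]
    rw [hfun]
    exact ((hasDerivAt_const_mul_arctan hκ.le t).const_mul 2).congr_deriv (by ring)
  · have hfun : timeCorrection κ = fun t ↦ -2 * (√(-κ) * artanh (√(-κ) * t)) := by
      ext t
      simp only [timeCorrection, if_neg hκ, mul_assoc]
    rw [hfun]
    refine ((hasDerivAt_const_mul_artanh (by linarith) ht (by linarith)).const_mul
      (-2)).congr_deriv ?_
    rw [show 1 - -κ * t ^ 2 = 1 + κ * t ^ 2 by ring]
    ring

namespace Admissible

variable {m p κ : ℝ} (h : Admissible m p κ)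
include h

omit h in
theorem min_le_coeff {y : ℝ} (hy : y ∈ Icc 0 m) : min p (p + 2 * κ * m) ≤ p + 2 * κ * y := by
  rcases le_total 0 κ with hκ | hκ
  · exact min_le_of_left_le (by nlinarith [hy.1])
  · exact min_le_of_right_le (by nlinarith [hy.2])

theorem coeff_pos {y : ℝ} (hy : y ∈ Icc 0 m) : 0 < p + 2 * κ * y :=
  (lt_min h.p_pos h.coeff_max_pos).trans_le (min_le_coeff hy)

theorem rate_nonneg {y : ℝ} (hy : y ∈ Icc 0 m) : 0 ≤ rate m p κ y :=
  div_nonneg (by linarith [hy.2]) (h.coeff_pos hy).le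

theorem rate_pos {y : ℝ} (hy : y ∈ Ico 0 m) : 0 < rate m p κ y :=
  div_pos (by linarith [hy.2]) (h.coeff_pos ⟨hy.1, hy.2.le⟩)

theorem rate_antitoneOn : AntitoneOn (rate m p κ) (Icc 0 m) := by
  intro x hx y hy hxy
  rw [rate, rate, div_le_div_iff₀ (h.coeff_pos hy) (h.coeff_pos hx)]
  linarith [mul_nonneg (sub_nonneg.2 hxy) h.coeff_max_pos.le]

theorem hasDerivAt_rate {y : ℝ} (hy : y ∈ Icc 0 m) :
    HasDerivAt (rate m p κ) (-2 * (p + 2 * κ * m) / (p + 2 * κ * y) ^ 2) y := by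
  have hnum : HasDerivAt (fun y : ℝ ↦ 2 * m - 2 * y) (-2) y := by
    simpa using ((hasDerivAt_id y).const_mul 2).const_sub (2 * m)
  have hcoeff : HasDerivAt (fun y : ℝ ↦ p + 2 * κ * y) (2 * κ) y := by
    simpa using ((hasDerivAt_id y).const_mul (2 * κ)).const_add p
  refine (hnum.div hcoeff (h.coeff_pos hy).ne').congr_deriv ?_
  congr 1
  ring

theorem coeff_mul_rate {y : ℝ} (hy : y ∈ Icc 0 m) :
    (p + 2 * κ * y) * rate m p κ y = 2 * m - 2 * y :=
  mul_div_cancel₀ _ (h.coeff_pos hy).ne'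

theorem one_add_mul_rate {y : ℝ} (hy : y ∈ Icc 0 m) :
    1 + κ * rate m p κ y = (p + 2 * κ * m) / (p + 2 * κ * y) := by
  rw [eq_div_iff (h.coeff_pos hy).ne']
  linear_combination κ * h.coeff_mul_rate hy

theorem one_sub_mul_rate {y : ℝ} (hy : y ∈ Icc 0 m) :
    1 - p / (2 * m) * rate m p κ y = y * (p + 2 * κ * m) / (m * (p + 2 * κ * y)) := by
  have hm := h.m_pos.ne'
  have hcoeff := (h.coeff_pos hy).ne'
  rw [eq_div_iff (mul_ne_zero hm hcoeff)]
  field_simp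
  linear_combination -p * h.coeff_mul_rate hy

theorem profileTime_eq (y : ℝ) :
    profileTime m p κ y = timeCorrection κ √(rate m p κ y) + 2 * √(p / (2 * m)) *
      artanh √(p * (2 * m - 2 * y) / (2 * m * (p + 2 * κ * y))) := by
  have hm := h.m_pos
  have hp := h.p_pos
  rw [profileTime, timeOfSqrtRate, ← sqrt_mul (by positivity) (rate m p κ y), rate,
    div_mul_div_comm]

theorem hasDerivAt_timeOfSqrtRate {y : ℝ} (hy : y ∈ Ioc 0 m) :
    HasDerivAt (timeOfSqrtRate m p κ) ((p + 2 * κ * y) ^ 2 / (y * (p + 2 * κ * m)))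
      √(rate m p κ y) := by
  have hm := h.m_pos
  have hp := h.p_pos
  have hq := h.coeff_max_pos
  have hy' : y ∈ Icc 0 m := ⟨hy.1.le, hy.2⟩
  have hcoeff := h.coeff_pos hy'
  have hsq : √(rate m p κ y) ^ 2 = rate m p κ y := sq_sqrt (h.rate_nonneg hy')
  have hadd := h.one_add_mul_rate hy'
  have hsub := h.one_sub_mul_rate hy'
  have hsub_pos : 0 < y * (p + 2 * κ * m) / (m * (p + 2 * κ * y)) :=
    div_pos (mul_pos hy.1 hq) (mul_pos hm hcoeff)
  have hcorrection := hasDerivAt_timeCorrection (κ := κ) (sqrt_nonneg (rate m p κ y))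
    (by rw [hsq, hadd]; positivity)
  have hmain := (hasDerivAt_const_mul_artanh (a := p / (2 * m)) (by positivity)
    (sqrt_nonneg (rate m p κ y)) (by rw [hsq]; linarith)).const_mul 2
  unfold timeOfSqrtRate
  simp only [mul_assoc] at hmain ⊢
  refine (hcorrection.add hmain).congr_deriv ?_
  have := hy.1.ne'
  rw [hsq, hadd, hsub]
  field_simp
  ring

theorem continuousOn_profileTime : ContinuousOn (profileTime m p κ) (Ioc 0 m) := fun _ hy ↦
  (ContinuousAt.comp (f := fun y ↦ √(rate m p κ y)) (h.hasDerivAt_timeOfSqrtRate hy).continuousAt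
    (h.hasDerivAt_rate ⟨hy.1.le, hy.2⟩).continuousAt.sqrt).continuousWithinAt

theorem hasDerivAt_profileTime {y : ℝ} (hy : y ∈ Ioo 0 m) :
    HasDerivAt (profileTime m p κ) (-1 / speed m p κ y) y := by
  have hy' : y ∈ Icc 0 m := ⟨hy.1.le, hy.2.le⟩
  have hrate := h.rate_pos ⟨hy.1.le, hy.2⟩
  refine ((h.hasDerivAt_timeOfSqrtRate ⟨hy.1, hy.2.le⟩).comp y
    ((h.hasDerivAt_rate hy').sqrt hrate.ne')).congr_deriv ?_
  have := hy.1.ne'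
  have := h.coeff_max_pos.ne'
  have := (sqrt_pos.2 hrate).ne'
  have := (h.coeff_pos hy').ne'
  rw [speed]
  field_simp

theorem speed_pos {y : ℝ} (hy : y ∈ Ioo 0 m) : 0 < speed m p κ y :=
  mul_pos hy.1 (sqrt_pos.2 (h.rate_pos ⟨hy.1.le, hy.2⟩))

theorem strictAntiOn_profileTime : StrictAntiOn (profileTime m p κ) (Ioc 0 m) := by
  refine strictAntiOn_of_deriv_neg (convex_Ioc 0 m) h.continuousOn_profileTime fun y hy ↦ ?_
  rw [interior_Ioc] at hy
  rw [(h.hasDerivAt_profileTime hy).deriv]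
  exact div_neg_of_neg_of_pos (by norm_num) (h.speed_pos hy)

theorem hasDerivAt_profileTime_add_log {y k : ℝ} (hy : y ∈ Ioo 0 m) :
    HasDerivAt (fun y ↦ profileTime m p κ y + k * log y) ((k - 1 / √(rate m p κ y)) / y) y := by
  refine ((h.hasDerivAt_profileTime hy).add
    ((Real.hasDerivAt_log hy.1.ne').const_mul k)).congr_deriv ?_
  have := (sqrt_pos.2 (h.rate_pos ⟨hy.1.le, hy.2⟩)).ne'
  have := hy.1.ne'
  rw [speed]
  field_simp
  ring

theorem continuousOn_profileTime_add_log (k : ℝ) :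
    ContinuousOn (fun y ↦ profileTime m p κ y + k * log y) (Ioc 0 m) :=
  h.continuousOn_profileTime.add
    ((continuousOn_log.mono fun _ hy ↦ hy.1.ne').const_smul k)

theorem log_div_le_profileTime {y : ℝ} (hy : y ∈ Ioc 0 m) :
    (log m - log y) / √(rate m p κ 0) ≤ profileTime m p κ y := by
  have anti : AntitoneOn (fun y ↦ profileTime m p κ y + 1 / √(rate m p κ 0) * log y) (Ioc 0 m) := by
    refine antitoneOn_of_deriv_nonpos (convex_Ioc 0 m) (h.continuousOn_profileTime_add_log _)
      (fun y hy ↦ ?_) fun y hy ↦ ?_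
    all_goals rw [interior_Ioc] at hy
    · exact (h.hasDerivAt_profileTime_add_log hy).differentiableAt.differentiableWithinAt
    · rw [(h.hasDerivAt_profileTime_add_log hy).deriv]
      have hrate := sqrt_pos.2 (h.rate_pos ⟨hy.1.le, hy.2⟩)
      have hrate_le := sqrt_le_sqrt
        (h.rate_antitoneOn ⟨le_rfl, h.m_pos.le⟩ ⟨hy.1.le, hy.2.le⟩ hy.1.le)
      exact div_nonpos_of_nonpos_of_nonneg
        (sub_nonpos.2 (one_div_le_one_div_of_le hrate hrate_le)) hy.1.le
  have hle := anti hy ⟨h.m_pos, le_rfl⟩ hy.2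
  simp only [profileTime_self, zero_add] at hle
  rw [sub_div, div_eq_mul_one_div, div_eq_mul_one_div (log y), mul_comm, mul_comm (log y)]
  linarith

theorem profileTime_le_add_log {a y : ℝ} (ha : a ∈ Ioo 0 m) (hy : y ∈ Ioc 0 a) :
    profileTime m p κ y ≤ profileTime m p κ a + (log a - log y) / √(rate m p κ a) := by
  have mono : MonotoneOn (fun y ↦ profileTime m p κ y + 1 / √(rate m p κ a) * log y) (Ioc 0 a) := by
    refine monotoneOn_of_deriv_nonneg (convex_Ioc 0 a)
      ((h.continuousOn_profileTime_add_log _).mono (Ioc_subset_Ioc_right ha.2.le))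
      (fun y hy ↦ ?_) fun y hy ↦ ?_
    all_goals
      rw [interior_Ioc] at hy
      have hym : y ∈ Ioo 0 m := ⟨hy.1, hy.2.trans ha.2⟩
    · exact (h.hasDerivAt_profileTime_add_log hym).differentiableAt.differentiableWithinAt
    · rw [(h.hasDerivAt_profileTime_add_log hym).deriv]
      have hrate := sqrt_pos.2 (h.rate_pos ⟨ha.1.le, ha.2⟩)
      have hrate_le := sqrt_le_sqrt
        (h.rate_antitoneOn ⟨hym.1.le, hym.2.le⟩ ⟨ha.1.le, ha.2.le⟩ hy.2.le)
      exact div_nonneg (sub_nonneg.2 (one_div_le_one_div_of_le hrate hrate_le)) hy.1.le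
  have hle := mono hy ⟨ha.1, le_rfl⟩ hy.2
  simp only at hle
  rw [sub_div, div_eq_mul_one_div, div_eq_mul_one_div (log y), mul_comm, mul_comm (log y)]
  linarith

theorem bijOn_profileTime : BijOn (profileTime m p κ) (Ioc 0 m) (Ici 0) := by
  have hm : m ∈ Ioc 0 m := ⟨h.m_pos, le_rfl⟩
  refine ⟨fun y hy ↦ ?_, h.strictAntiOn_profileTime.injOn, fun T hT ↦ ?_⟩
  · simpa only [profileTime_self, mem_Ici] using
      h.strictAntiOn_profileTime.antitoneOn hy hm hy.2
  · have hrate := sqrt_pos.2 (h.rate_pos ⟨le_rfl, h.m_pos⟩)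
    set y := m * exp (-(√(rate m p κ 0) * T)) with hy
    have hymem : y ∈ Ioc 0 m := ⟨mul_pos h.m_pos (exp_pos _), mul_le_of_le_one_right h.m_pos.le
      (exp_le_one_iff.2 (neg_nonpos.2 (mul_nonneg hrate.le hT)))⟩
    have hTy : T ≤ profileTime m p κ y := by
      refine le_of_eq_of_le ?_ (h.log_div_le_profileTime hymem)
      rw [hy, log_mul h.m_pos.ne' (exp_pos _).ne', log_exp]
      field_simp
      ring
    have hsub : Icc y m ⊆ Ioc 0 m := fun z hz ↦ ⟨hymem.1.trans_le hz.1, hz.2⟩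
    have hivt := intermediate_value_Icc' hymem.2 (h.continuousOn_profileTime.mono hsub)
    rw [profileTime_self] at hivt
    obtain ⟨z, hz, hzT⟩ := hivt ⟨hT, hTy⟩
    exact ⟨z, hsub hz, hzT⟩

end Admissible

namespace Admissible

variable {m p κ : ℝ} (h : Admissible m p κ)
include h

theorem profile_mem (x : ℝ) : profile m p κ x ∈ Ioc 0 m :=
  Function.invFunOn_mem (h.bijOn_profileTime.surjOn (abs_nonneg x))

theorem profile_mem_Icc (x : ℝ) : profile m p κ x ∈ Icc 0 m :=
  Ioc_subset_Icc_self (h.profile_mem x)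

theorem profileTime_profile (x : ℝ) : profileTime m p κ (profile m p κ x) = |x| :=
  Function.invFunOn_eq (h.bijOn_profileTime.surjOn (abs_nonneg x))

theorem lt_profile_iff {x y : ℝ} (hy : y ∈ Ioc 0 m) :
    y < profile m p κ x ↔ |x| < profileTime m p κ y := by
  rw [← h.profileTime_profile x, h.strictAntiOn_profileTime.lt_iff_gt (h.profile_mem x) hy]

theorem profile_lt_iff {x y : ℝ} (hy : y ∈ Ioc 0 m) :
    profile m p κ x < y ↔ profileTime m p κ y < |x| := by
  rw [← h.profileTime_profile x, h.strictAntiOn_profileTime.lt_iff_gt hy (h.profile_mem x)]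

theorem profile_zero : profile m p κ 0 = m := by
  refine (h.profile_mem 0).2.eq_of_not_lt fun hlt ↦ ?_
  rw [h.profile_lt_iff ⟨h.m_pos, le_rfl⟩, profileTime_self, abs_zero] at hlt
  exact hlt.false

theorem profile_le_profile_zero (x : ℝ) : profile m p κ x ≤ profile m p κ 0 :=
  (h.profile_mem x).2.trans_eq h.profile_zero.symm

theorem profile_mem_Ioo {x : ℝ} (hx : x ≠ 0) : profile m p κ x ∈ Ioo 0 m := by
  refine ⟨(h.profile_mem x).1, ?_⟩
  rw [h.profile_lt_iff ⟨h.m_pos, le_rfl⟩, profileTime_self]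
  exact abs_pos.2 hx

theorem continuous_profile : Continuous (profile m p κ) := by
  refine continuous_iff_continuousAt.2 fun x ↦ tendsto_order.2 ⟨fun a ha ↦ ?_, fun b hb ↦ ?_⟩
  · have hx := h.profile_mem x
    have ha' : max a (profile m p κ x / 2) < profile m p κ x := max_lt ha (half_lt_self hx.1)
    have hmem : max a (profile m p κ x / 2) ∈ Ioc 0 m :=
      ⟨lt_max_of_lt_right (half_pos hx.1), ha'.le.trans hx.2⟩
    filter_upwards [continuous_abs.continuousAt.eventually_lt_const
      ((h.lt_profile_iff hmem).1 ha')] with z hz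
    exact (le_max_left _ _).trans_lt ((h.lt_profile_iff hmem).2 hz)
  · rcases le_or_gt b m with hbm | hbm
    · have hmem : b ∈ Ioc 0 m := ⟨(h.profile_mem x).1.trans hb, hbm⟩
      filter_upwards [continuous_abs.continuousAt.eventually_const_lt
        ((h.profile_lt_iff hmem).1 hb)] with z hz
      exact (h.profile_lt_iff hmem).2 hz
    · exact Eventually.of_forall fun z ↦ (h.profile_mem z).2.trans_lt hbm

theorem coeff_profile_pos (x : ℝ) : 0 < p + 2 * κ * profile m p κ x :=
  h.coeff_pos (h.profile_mem_Icc x)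

theorem continuous_rate_profile : Continuous fun x ↦ rate m p κ (profile m p κ x) := by
  have := h.continuous_profile
  unfold rate
  exact Continuous.div (by fun_prop) (by fun_prop) fun x ↦ (h.coeff_profile_pos x).ne'

theorem continuous_speed_profile : Continuous fun x ↦ speed m p κ (profile m p κ x) :=
  h.continuous_profile.mul h.continuous_rate_profile.sqrt

theorem continuous_accel_profile : Continuous fun x ↦ accel m p κ (profile m p κ x) := by
  have := h.continuous_profile
  have := h.continuous_rate_profile
  unfold accel
  exact Continuous.sub (by fun_prop) <|
    Continuous.div (by fun_prop) (by fun_prop) fun x ↦ (pow_pos (h.coeff_profile_pos x) 2).ne'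

theorem abs_profileDeriv_le_speed (x : ℝ) :
    |profileDeriv m p κ x| ≤ speed m p κ (profile m p κ x) := by
  have hspeed : 0 ≤ speed m p κ (profile m p κ x) :=
    mul_nonneg (h.profile_mem x).1.le (sqrt_nonneg _)
  rw [profileDeriv, abs_neg, abs_mul, abs_of_nonneg hspeed]
  refine mul_le_of_le_one_left hspeed ?_
  rcases Real.sign_apply_eq x with hs | hs | hs <;> simp [hs]

theorem continuousAt_profileDeriv_zero : ContinuousAt (profileDeriv m p κ) 0 := by
  have speed_zero : Tendsto (fun x ↦ speed m p κ (profile m p κ x)) (𝓝 0) (𝓝 0) := by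
    simpa [h.profile_zero, speed_self] using h.continuous_speed_profile.tendsto 0
  rw [ContinuousAt, profileDeriv_zero m p κ, tendsto_zero_iff_abs_tendsto_zero]
  exact squeeze_zero (fun x ↦ abs_nonneg _) h.abs_profileDeriv_le_speed speed_zero

theorem hasDerivAt_profile (x : ℝ) : HasDerivAt (profile m p κ) (profileDeriv m p κ x) x := by
  refine hasDerivAt_of_parity (ε := 1) (by simp [profile_neg]) (by simp [profileDeriv_neg])
    h.continuous_profile.continuousAt h.continuousAt_profileDeriv_zero (fun x hx ↦ ?_) x
  have hmem := h.profile_mem_Ioo hx.ne'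
  have left_inverse : ∀ᶠ y in 𝓝 x, profileTime m p κ (profile m p κ y) = y := by
    filter_upwards [eventually_gt_nhds hx] with y hy
    rw [h.profileTime_profile, abs_of_pos hy]
  refine (HasDerivAt.of_local_left_inverse h.continuous_profile.continuousAt
    (h.hasDerivAt_profileTime hmem) (div_ne_zero (by norm_num) (h.speed_pos hmem).ne')
    left_inverse).congr_deriv ?_
  rw [profileDeriv_of_pos hx, inv_div, div_neg, div_one]

theorem deriv_profile_neg {x : ℝ} (hx : 0 < x) : deriv (profile m p κ) x < 0 := by
  rw [(h.hasDerivAt_profile x).deriv, profileDeriv_of_pos hx, neg_lt_zero]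
  exact h.speed_pos (h.profile_mem_Ioo hx.ne')

theorem hasDerivAt_speed {y : ℝ} (hy : y ∈ Ioo 0 m) :
    HasDerivAt (speed m p κ) (accel m p κ y / speed m p κ y) y := by
  have hrate := h.rate_pos ⟨hy.1.le, hy.2⟩
  refine ((hasDerivAt_id y).mul
    ((h.hasDerivAt_rate ⟨hy.1.le, hy.2.le⟩).sqrt hrate.ne')).congr_deriv ?_
  rw [eq_div_iff (h.speed_pos hy).ne', speed, accel, id]
  have hne := (sqrt_pos.2 hrate).ne'
  field_simp
  rw [sq_sqrt hrate.le]
  ring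

theorem hasDerivAt_profileDeriv (x : ℝ) :
    HasDerivAt (profileDeriv m p κ) (accel m p κ (profile m p κ x)) x := by
  refine hasDerivAt_of_parity (ε := -1) (by simp [profileDeriv_neg]) (by simp [profile_neg])
    h.continuousAt_profileDeriv_zero h.continuous_accel_profile.continuousAt (fun x hx ↦ ?_) x
  have hmem := h.profile_mem_Ioo hx.ne'
  have near : profileDeriv m p κ =ᶠ[𝓝 x] fun y ↦ -speed m p κ (profile m p κ y) := by
    filter_upwards [eventually_gt_nhds hx] with y hy using profileDeriv_of_pos hy
  refine (((h.hasDerivAt_speed hmem).comp x (h.hasDerivAt_profile x)).neg.congr_of_eventuallyEq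
    near).congr_deriv ?_
  have := (h.speed_pos hmem).ne'
  rw [profileDeriv_of_pos hx]
  field_simp

theorem profileDeriv_sq (x : ℝ) :
    profileDeriv m p κ x ^ 2 * (p + 2 * κ * profile m p κ x)
      = 2 * profile m p κ x ^ 2 * (m - profile m p κ x) := by
  have hmem := h.profile_mem_Icc x
  have hsq : profileDeriv m p κ x ^ 2 = profile m p κ x ^ 2 * rate m p κ (profile m p κ x) := by
    rcases eq_or_ne x 0 with rfl | hx
    · simp [profileDeriv_zero, h.profile_zero, rate_self]
    · rw [profileDeriv, neg_sq, mul_pow, speed, mul_pow, sq_sqrt (h.rate_nonneg hmem)]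
      rcases Real.sign_apply_eq_of_ne_zero x hx with hs | hs <;> simp [hs]
  linear_combination (p + 2 * κ * profile m p κ x) * hsq +
    profile m p κ x ^ 2 * h.coeff_mul_rate hmem

theorem coeff_mul_accel {y v : ℝ} (hy : y ∈ Icc 0 m)
    (hv : v ^ 2 * (p + 2 * κ * y) = 2 * y ^ 2 * (m - y)) :
    (p + 2 * κ * y) * accel m p κ y + κ * v ^ 2 = 2 * m * y - 3 * y ^ 2 := by
  have hcoeff := (h.coeff_pos hy).ne'
  have hrate := h.coeff_mul_rate hy
  have hone := h.one_add_mul_rate hy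
  have hvsq : v ^ 2 = y ^ 2 * rate m p κ y := by
    refine mul_right_cancel₀ hcoeff ?_
    linear_combination hv - y ^ 2 * hrate
  rw [eq_div_iff hcoeff] at hone
  rw [hvsq, accel]
  field_simp
  linear_combination (p + 2 * κ * y) * y * hrate + y ^ 2 * hone

theorem exists_profile_le_exp : ∃ C > 0, ∃ A, ∀ x, profile m p κ x ≤ A * exp (-C * |x|) := by
  have ha := h.profile_mem_Ioo one_ne_zero
  set a := profile m p κ 1 with haDef
  have hC := sqrt_pos.2 (h.rate_pos ⟨ha.1.le, ha.2⟩)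
  set C := √(rate m p κ a)
  refine ⟨C, hC, m * exp C, fun x ↦ ?_⟩
  have hx := h.profile_mem x
  rw [mul_assoc, ← exp_add]
  rcases le_or_gt (profile m p κ x) a with hxa | hxa
  · have time_le := h.profileTime_le_add_log ha ⟨hx.1, hxa⟩
    rw [h.profileTime_profile, haDef, h.profileTime_profile, ← haDef, abs_one,
      ← sub_le_iff_le_add', le_div_iff₀ hC] at time_le
    have log_le : log (profile m p κ x) ≤ log a + (C + -C * |x|) := by linarith
    calc profile m p κ x ≤ exp (log a + (C + -C * |x|)) := (log_le_iff_le_exp hx.1).1 log_le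
      _ = a * exp (C + -C * |x|) := by rw [exp_add, exp_log ha.1]
      _ ≤ m * exp (C + -C * |x|) := by gcongr; exact ha.2.le
  · have hx1 : |x| < 1 := by
      rwa [h.lt_profile_iff ⟨ha.1, ha.2.le⟩, haDef, h.profileTime_profile, abs_one] at hxa
    have one_le : 1 ≤ exp (C + -C * |x|) := one_le_exp (by nlinarith)
    exact hx.2.trans (le_mul_of_one_le_right h.m_pos.le one_le)

end Admissible

/-! ### Decay of all derivatives -/

section Decay

variable {E : Type*} [NormedAddCommGroup E] [NormedSpace ℝ E]
  {A : Type*} [NormedRing A] [NormedAlgebra ℝ A]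

/-- `f` is of class `C^n`, and its derivatives up to order `n` are `O(w)` uniformly on `ℝ`
(hence the filter `⊤`). -/
def IsBigOToOrder (n : ℕ) (w : ℝ → ℝ) (f : ℝ → E) : Prop :=
  ContDiff ℝ n f ∧ ∀ k ≤ n, iteratedDeriv k f =O[⊤] w

namespace IsBigOToOrder

variable {n : ℕ} {w w₁ w₂ : ℝ → ℝ} {f f' g : ℝ → E}

theorem of_continuous (hf : Continuous f) (h : f =O[⊤] w) : IsBigOToOrder 0 w f :=
  ⟨contDiff_zero.2 hf, fun k hk ↦ by rwa [Nat.le_zero.1 hk, iteratedDeriv_zero]⟩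

theorem succ (hderiv : ∀ x, HasDerivAt f (f' x) x) (h : f =O[⊤] w) (h' : IsBigOToOrder n w f') :
    IsBigOToOrder (n + 1) w f := by
  have hf' : deriv f = f' := funext fun x ↦ (hderiv x).deriv
  refine ⟨?_, fun k hk ↦ ?_⟩
  · push_cast
    exact contDiff_succ_iff_deriv.2
      ⟨fun x ↦ (hderiv x).differentiableAt, by simp, hf' ▸ h'.1⟩
  · cases k with
    | zero => rwa [iteratedDeriv_zero]
    | succ k =>
      rw [iteratedDeriv_succ', hf']
      exact h'.2 k (Nat.le_of_succ_le_succ hk)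

theorem of_le {m : ℕ} (h : IsBigOToOrder n w f) (hmn : m ≤ n) : IsBigOToOrder m w f :=
  ⟨h.1.of_le (by exact_mod_cast hmn), fun k hk ↦ h.2 k (hk.trans hmn)⟩

theorem deriv (h : IsBigOToOrder (n + 1) w f) : IsBigOToOrder n w (deriv f) := by
  refine ⟨(contDiff_succ_iff_deriv.1 (by exact_mod_cast h.1)).2.2, fun k hk ↦ ?_⟩
  rw [← iteratedDeriv_succ']
  exact h.2 (k + 1) (Nat.succ_le_succ hk)

theorem congr (h : IsBigOToOrder n w f) (hfg : ∀ x, f x = g x) : IsBigOToOrder n w g :=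
  funext hfg ▸ h

theorem isBigO (h : IsBigOToOrder n w f) : f =O[⊤] w := by
  simpa using h.2 0 n.zero_le

theorem trans_isBigO (h : IsBigOToOrder n w₁ f) (hw : w₁ =O[⊤] w₂) : IsBigOToOrder n w₂ f :=
  ⟨h.1, fun k hk ↦ (h.2 k hk).trans hw⟩

theorem const (n : ℕ) (c : E) : IsBigOToOrder n 1 fun _ : ℝ ↦ c := by
  induction n generalizing c with
  | zero => exact of_continuous continuous_const (isBigO_const_const c one_ne_zero ⊤)
  | succ n ih =>
    exact succ (fun x ↦ hasDerivAt_const x c) (isBigO_const_const c one_ne_zero ⊤) (ih 0)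

theorem add (hf : IsBigOToOrder n w f) (hg : IsBigOToOrder n w g) :
    IsBigOToOrder n w (f + g) := by
  refine ⟨hf.1.add hg.1, fun k hk ↦ ?_⟩
  have hk' : (k : WithTop ℕ∞) ≤ n := by exact_mod_cast hk
  have hsum : iteratedDeriv k (f + g) = iteratedDeriv k f + iteratedDeriv k g :=
    funext fun x ↦ iteratedDeriv_add (hf.1.of_le hk').contDiffAt (hg.1.of_le hk').contDiffAt
  exact hsum ▸ (hf.2 k hk).add (hg.2 k hk)

theorem mul {f g : ℝ → A} (hf : IsBigOToOrder n w₁ f) (hg : IsBigOToOrder n w₂ g) :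
    IsBigOToOrder n (w₁ * w₂) (f * g) := by
  refine ⟨hf.1.mul hg.1, fun k hk ↦ ?_⟩
  have hk' : (k : WithTop ℕ∞) ≤ n := by exact_mod_cast hk
  have leibniz (x : ℝ) : ‖iteratedDeriv k (f * g) x‖ ≤ ‖∑ i ∈ Finset.range (k + 1),
      (k.choose i : ℝ) * ‖iteratedDeriv i f x‖ * ‖iteratedDeriv (k - i) g x‖‖ := by
    simp only [← norm_iteratedFDeriv_eq_norm_iteratedDeriv]
    exact (norm_iteratedFDeriv_mul_le hf.1 hg.1 x hk').trans (le_abs_self _)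
  refine (isBigO_of_le ⊤ leibniz).trans (IsBigO.fun_sum fun i hi ↦ ?_)
  have hi' : i ≤ k := Finset.mem_range_succ_iff.1 hi
  exact ((hf.2 i (hi'.trans hk)).norm_left.const_mul_left _).mul
    (hg.2 (k - i) (k.sub_le i |>.trans hk)).norm_left

theorem bounded_mul {f g : ℝ → A} (hf : IsBigOToOrder n 1 f) (hg : IsBigOToOrder n w g) :
    IsBigOToOrder n w (f * g) := by
  simpa using hf.mul hg

theorem mul_bounded {f g : ℝ → A} (hf : IsBigOToOrder n w f) (hg : IsBigOToOrder n 1 g) :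
    IsBigOToOrder n w (f * g) := by
  simpa using hf.mul hg

theorem const_mul {f : ℝ → A} (c : A) (hf : IsBigOToOrder n w f) :
    IsBigOToOrder n w fun x ↦ c * f x :=
  (const n c).bounded_mul hf

theorem ofReal {f : ℝ → ℝ} (hf : IsBigOToOrder n w f) :
    IsBigOToOrder n w fun x ↦ (f x : ℂ) := by
  refine ⟨Complex.ofRealCLM.contDiff.comp hf.1, fun k hk ↦ ?_⟩
  refine (isBigO_of_le ⊤ fun x ↦ le_of_eq ?_).trans (hf.2 k hk)
  have hk' : (k : WithTop ℕ∞) ≤ n := by exact_mod_cast hk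
  simp only [← norm_iteratedFDeriv_eq_norm_iteratedDeriv]
  exact Complex.ofRealLI.norm_iteratedFDeriv_comp_left hf.1.contDiffAt hk'

end IsBigOToOrder

end Decay

theorem exp_neg_mul_abs_isBigO_one {C : ℝ} (hC : 0 ≤ C) :
    (fun x : ℝ ↦ exp (-C * |x|)) =O[⊤] (1 : ℝ → ℝ) :=
  isBigO_of_le ⊤ fun x ↦ by
    rw [norm_of_nonneg (exp_pos _).le, Pi.one_apply, norm_one, exp_le_one_iff]
    nlinarith [abs_nonneg x]

namespace Admissible

variable {m p κ : ℝ} (h : Admissible m p κ)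
include h

theorem profileDeriv_isBigO : profileDeriv m p κ =O[⊤] profile m p κ :=
  isBigO_top.2 ⟨√(rate m p κ 0), fun x ↦ by
    have hx := h.profile_mem_Icc x
    have hrate := h.rate_antitoneOn ⟨le_rfl, h.m_pos.le⟩ hx hx.1
    rw [norm_of_nonneg hx.1, mul_comm]
    exact (h.abs_profileDeriv_le_speed x).trans
      (mul_le_mul_of_nonneg_left (sqrt_le_sqrt hrate) hx.1)⟩

theorem inv_coeff_profile_isBigO :
    (fun x ↦ (p + 2 * κ * profile m p κ x)⁻¹) =O[⊤] (1 : ℝ → ℝ) :=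
  isBigO_top.2 ⟨(min p (p + 2 * κ * m))⁻¹, fun x ↦ by
    rw [norm_of_nonneg (inv_nonneg.2 (h.coeff_profile_pos x).le), Pi.one_apply, norm_one, mul_one]
    exact inv_anti₀ (lt_min h.p_pos h.coeff_max_pos) (min_le_coeff (h.profile_mem_Icc x))⟩

theorem hasDerivAt_inv_coeff_profile (x : ℝ) :
    HasDerivAt (fun x ↦ (p + 2 * κ * profile m p κ x)⁻¹)
      (-2 * κ * (profileDeriv m p κ x *
        ((p + 2 * κ * profile m p κ x)⁻¹ * (p + 2 * κ * profile m p κ x)⁻¹))) x := by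
  refine ((((h.hasDerivAt_profile x).const_mul (2 * κ)).const_add p).fun_inv
    (h.coeff_profile_pos x).ne').congr_deriv ?_
  rw [div_eq_mul_inv, sq, mul_inv]
  ring

theorem accel_profile (x : ℝ) :
    accel m p κ (profile m p κ x) = (p + 2 * κ * profile m p κ x)⁻¹ *
      (2 * m * profile m p κ x + -3 * (profile m p κ x * profile m p κ x) +
        -κ * (profileDeriv m p κ x * profileDeriv m p κ x)) := by
  rw [eq_inv_mul_iff_mul_eq₀ (h.coeff_profile_pos x).ne']
  linear_combination h.coeff_mul_accel (h.profile_mem_Icc x) (h.profileDeriv_sq x)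

theorem exists_isBigOToOrder_profile :
    ∃ C > 0, ∀ n, IsBigOToOrder n (fun x ↦ exp (-C * |x|)) (profile m p κ) := by
  obtain ⟨C, hC, B, hB⟩ := h.exists_profile_le_exp
  set w : ℝ → ℝ := fun x ↦ exp (-C * |x|)
  have hw : w =O[⊤] (1 : ℝ → ℝ) := exp_neg_mul_abs_isBigO_one hC.le
  have hy : profile m p κ =O[⊤] w := isBigO_top.2 ⟨B, fun x ↦ by
    simpa [w, abs_of_pos (h.profile_mem x).1] using hB x⟩
  have hy' := h.profileDeriv_isBigO.trans hy
  have hq := h.inv_coeff_profile_isBigO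
  have hderiv' (x : ℝ) := (h.hasDerivAt_profileDeriv x).congr_deriv (h.accel_profile x)
  suffices main : ∀ n, IsBigOToOrder n w (profile m p κ) ∧ IsBigOToOrder n w (profileDeriv m p κ) ∧
      IsBigOToOrder n 1 fun x ↦ (p + 2 * κ * profile m p κ x)⁻¹ from ⟨C, hC, fun n ↦ (main n).1⟩
  intro n
  induction n with
  | zero =>
    exact ⟨.of_continuous h.continuous_profile hy,
      .of_continuous (continuous_iff_continuousAt.2 fun x ↦ (hderiv' x).continuousAt) hy',
      .of_continuous (continuous_iff_continuousAt.2 fun x ↦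
        (h.hasDerivAt_inv_coeff_profile x).continuousAt) hq⟩
  | succ n ih =>
    obtain ⟨ihy, ihy', ihq⟩ := ih
    have hyy := (ihy.trans_isBigO hw).bounded_mul ihy
    have hyy' := (ihy'.trans_isBigO hw).bounded_mul ihy'
    exact ⟨.succ h.hasDerivAt_profile hy ihy',
      .succ hderiv' hy' <| ihq.bounded_mul <|
        ((ihy.const_mul (2 * m)).add (hyy.const_mul (-3))).add (hyy'.const_mul (-κ)),
      .succ h.hasDerivAt_inv_coeff_profile hq <| .const_mul (-2 * κ) <|
        (ihy'.trans_isBigO hw).bounded_mul (ihq.bounded_mul ihq)⟩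

end Admissible

/-! ### Localized solutions of the profile equation -/

/-- `y` is a `C²` solution of the quasilinear profile equation `(p + 2κy) y'' + κ y'² = 2my - 3y²`
whose first integral has the value it takes at a solution that decays at infinity. The
regularity excludes compactly supported `y` of class `C¹`, which exist when `p = 0`. -/
structure IsProfileSol (m p κ : ℝ) (y : ℝ → ℝ) : Prop where
  contDiff : ContDiff ℝ 2 y
  first_order (x : ℝ) : deriv y x ^ 2 * (p + 2 * κ * y x) = 2 * y x ^ 2 * (m - y x)
  second_order (x : ℝ) :
    (p + 2 * κ * y x) * deriv (deriv y) x + κ * deriv y x ^ 2 = 2 * m * y x - 3 * y x ^ 2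

theorem Admissible.isProfileSol_profile {m p κ : ℝ} (h : Admissible m p κ) :
    IsProfileSol m p κ (profile m p κ) := by
  have hderiv : deriv (profile m p κ) = profileDeriv m p κ :=
    funext fun x ↦ (h.hasDerivAt_profile x).deriv
  obtain ⟨_, -, hdecay⟩ := h.exists_isBigOToOrder_profile
  refine ⟨(hdecay 2).1, fun x ↦ ?_, fun x ↦ ?_⟩ <;> rw [hderiv]
  · exact h.profileDeriv_sq x
  · rw [(h.hasDerivAt_profileDeriv x).deriv]
    exact h.coeff_mul_accel (h.profile_mem_Icc x) (h.profileDeriv_sq x)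

namespace IsProfileSol

variable {m p κ : ℝ} {y : ℝ → ℝ}

theorem const_mul (s : ℝ) (hy : IsProfileSol m p κ y) :
    IsProfileSol (s * m) (s * p) κ fun x ↦ s * y x := by
  have hderiv : deriv (fun x ↦ s * y x) = fun x ↦ s * deriv y x := by
    ext x
    rw [deriv_const_mul_field]
  refine ⟨contDiff_const.mul hy.contDiff, fun x ↦ ?_, fun x ↦ ?_⟩ <;> rw [hderiv]
  · linear_combination s ^ 3 * hy.first_order x
  · rw [deriv_const_mul_field]
    linear_combination s ^ 2 * hy.second_order x

theorem exists_max (hy : IsProfileSol m p κ y) (hlim : Tendsto y (cocompact ℝ) (𝓝 0)) {x₁ : ℝ}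
    (hx₁ : 0 < y x₁) : ∃ x₀, y x₀ = m ∧ deriv y x₀ = 0 ∧ ∀ x, y x ≤ m := by
  obtain ⟨x₀, hmax⟩ := hy.contDiff.continuous.exists_forall_ge' x₁
    ((hlim.eventually_lt_const hx₁).mono fun _ ↦ le_of_lt)
  have hderiv : deriv y x₀ = 0 := IsLocalMax.deriv_eq_zero (Eventually.of_forall hmax)
  have hpos : 0 < y x₀ := hx₁.trans_le (hmax x₁)
  have hm : y x₀ = m := by
    have henergy := hy.first_order x₀
    rw [hderiv, zero_pow two_ne_zero, zero_mul, zero_eq_mul] at henergy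
    exact (sub_eq_zero.1 (henergy.resolve_left (by positivity))).symm
  exact ⟨x₀, hm, hderiv, fun x ↦ hm ▸ hmax x⟩

section Localized

variable (hy : IsProfileSol m p κ y) (hlim : Tendsto y (cocompact ℝ) (𝓝 0)) {x₁ : ℝ}
  (hx₁ : 0 < y x₁)
include hy hlim hx₁

theorem m_pos : 0 < m := by
  obtain ⟨-, -, -, hmax⟩ := hy.exists_max hlim hx₁
  exact hx₁.trans_le (hmax x₁)

theorem nonneg (x : ℝ) : 0 ≤ y x := by
  by_contra! hneg
  have := (hy.const_mul (-1)).m_pos (by simpa using hlim.const_mul (-1)) (x₁ := x) (by linarith)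
  linarith [hy.m_pos hlim hx₁]

theorem exists_eq {t : ℝ} (ht : t ∈ Ioc 0 m) : ∃ x, y x = t := by
  obtain ⟨x₀, hx₀, -⟩ := hy.exists_max hlim hx₁
  obtain ⟨x₂, hx₂⟩ := (hlim.eventually_lt_const ht.1).exists
  exact mem_range_of_exists_le_of_exists_ge hy.contDiff.continuous ⟨x₂, hx₂.le⟩
    ⟨x₀, ht.2.trans hx₀.ge⟩

theorem coeff_nonneg {t : ℝ} (ht : t ∈ Icc 0 m) : 0 ≤ p + 2 * κ * t := by
  have hpos : Ioo 0 m ⊆ {t | 0 ≤ p + 2 * κ * t} := fun t ht ↦ by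
    obtain ⟨x, rfl⟩ := hy.exists_eq hlim hx₁ ⟨ht.1, ht.2.le⟩
    have hprod : 0 < deriv y x ^ 2 * (p + 2 * κ * y x) := by
      rw [hy.first_order]
      exact mul_pos (mul_pos two_pos (pow_pos ht.1 2)) (sub_pos.2 ht.2)
    exact (pos_of_mul_pos_right hprod (sq_nonneg _)).le
  have hclosed : IsClosed {t | 0 ≤ p + 2 * κ * t} :=
    isClosed_le continuous_const (by fun_prop)
  refine closure_minimal hpos hclosed ?_
  rwa [closure_Ioo (hy.m_pos hlim hx₁).ne]

theorem coeff_max_pos : 0 < p + 2 * κ * m := by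
  have hm := hy.m_pos hlim hx₁
  refine (hy.coeff_nonneg hlim hx₁ ⟨hm.le, le_rfl⟩).lt_of_ne' fun hzero ↦ ?_
  obtain ⟨x₀, hx₀, hderiv, -⟩ := hy.exists_max hlim hx₁
  have hsecond := hy.second_order x₀
  rw [hx₀, hderiv, hzero] at hsecond
  nlinarith [pow_pos hm 2]

end Localized

-- A degenerate profile solves `2κy'' = m - 2y` on the support of `y` and `y'' = 0` off it, so `y''`
-- would jump by `m / (2κ)` at the boundary of the support.
theorem second_order_of_degenerate (hy : IsProfileSol m 0 κ y) (hm : m ≠ 0) {x₀ : ℝ}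
    (hx₀ : y x₀ ≠ 0) (x : ℝ) : 2 * κ * deriv (deriv y) x = m - 2 * y x := by
  have hcont : Continuous (deriv (deriv y)) := (contDiff_one_deriv hy.contDiff).continuous_deriv_one
  have hcont' := hy.contDiff.continuous
  set s := {x | 2 * κ * deriv (deriv y) x = m - 2 * y x}
  have hclosed : IsClosed s := isClosed_eq (by fun_prop) (by fun_prop)
  have hsupport (x : ℝ) (hx : y x ≠ 0) : x ∈ s := by
    refine mul_left_cancel₀ (pow_ne_zero 2 hx) ?_
    linear_combination y x * hy.second_order x - hy.first_order x / 2
  have hcompl : sᶜ = {x | y x = 0} ∩ {x | deriv (deriv y) x = 0} := by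
    ext x
    refine ⟨fun hx ↦ ?_, fun ⟨(hzero : y x = 0), (hzero' : deriv (deriv y) x = 0)⟩
      (hx : 2 * κ * deriv (deriv y) x = m - 2 * y x) ↦ hm ?_⟩
    · have hnear : y =ᶠ[𝓝 x] fun _ ↦ 0 := by
        filter_upwards [hclosed.isOpen_compl.mem_nhds hx] with z hz
        exact not_imp_comm.1 (hsupport z) hz
      exact ⟨hnear.eq_of_nhds, by simpa using hnear.deriv.deriv_eq⟩
    · linear_combination 2 * κ * hzero' + 2 * hzero - hx
  have hopen : IsOpen s := isClosed_compl_iff.1 <| hcompl ▸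
    (isClosed_eq hcont' continuous_const).inter (isClosed_eq hcont continuous_const)
  exact (IsClopen.eq_univ ⟨hclosed, hopen⟩ ⟨x₀, hsupport x₀ hx₀⟩).ge (mem_univ x)

theorem p_ne_zero (hy : IsProfileSol m p κ y) (hlim : Tendsto y (cocompact ℝ) (𝓝 0)) {x₁ : ℝ}
    (hx₁ : 0 < y x₁) : p ≠ 0 := by
  rintro rfl
  have hm := hy.m_pos hlim hx₁
  have hκ : κ ≠ 0 := by
    rintro rfl
    simpa using hy.coeff_max_pos hlim hx₁
  have hsecond := hy.second_order_of_degenerate hm.ne' hx₁.ne'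
  have hlim' : Tendsto y atTop (𝓝 0) := hlim.mono_left atTop_le_cocompact
  have hderiv : Tendsto (deriv y) atTop (𝓝 0) := by
    have hsq (x : ℝ) : deriv y x ^ 2 = (m * y x - y x ^ 2) / κ := by
      rw [eq_div_iff hκ]
      linear_combination hy.second_order x - y x * hsecond x
    have hsq_lim : Tendsto (fun x ↦ deriv y x ^ 2) atTop (𝓝 0) := by
      simp only [hsq]
      simpa using ((hlim'.const_mul m).sub (hlim'.pow 2)).div_const κ
    rw [tendsto_zero_iff_abs_tendsto_zero]
    simpa [Function.comp_def, sqrt_sq_eq_abs] using hsq_lim.sqrt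
  have hderiv' : Tendsto (deriv (deriv y)) atTop (𝓝 (m / (2 * κ))) := by
    have heq : deriv (deriv y) = fun x ↦ (m - 2 * y x) / (2 * κ) := funext fun x ↦ by
      rw [eq_div_iff (by simpa using hκ), ← hsecond x, mul_comm]
    rw [heq]
    simpa using ((hlim'.const_mul 2).const_sub m).div_const (2 * κ)
  exact div_ne_zero hm.ne' (by simpa using hκ) <|
    eq_zero_of_tendsto_of_tendsto_deriv (hasDerivAt_deriv_of_contDiff_two hy.contDiff) hderiv
      hderiv'

theorem admissible (hy : IsProfileSol m p κ y) (hlim : Tendsto y (cocompact ℝ) (𝓝 0)) {x₁ : ℝ}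
    (hx₁ : 0 < y x₁) : Admissible m p κ := by
  have hm := hy.m_pos hlim hx₁
  refine ⟨hm, ?_, hy.coeff_max_pos hlim hx₁⟩
  have hp : 0 ≤ p := by simpa using hy.coeff_nonneg hlim hx₁ ⟨le_rfl, hm.le⟩
  exact hp.lt_of_ne' (hy.p_ne_zero hlim hx₁)

theorem exists_eq_profile (hy : IsProfileSol m p κ y) (hlim : Tendsto y (cocompact ℝ) (𝓝 0))
    {x₁ : ℝ} (hx₁ : 0 < y x₁) : ∃ x₀, ∀ x, y x = profile m p κ (x - x₀) := by
  have h := hy.admissible hlim hx₁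
  obtain ⟨x₀, hx₀, hderiv, hmax⟩ := hy.exists_max hlim hx₁
  have hmem (x : ℝ) : y x ∈ Icc 0 m := ⟨hy.nonneg hlim hx₁ x, hmax x⟩
  obtain ⟨K, hK⟩ : ∃ K, LipschitzOnWith K (accel m p κ) (Icc 0 m) := by
    refine ContDiffOn.exists_lipschitzOnWith (n := 1) ?_ one_ne_zero (convex_Icc 0 m) isCompact_Icc
    have hcoeff : ContDiff ℝ 1 fun y ↦ p + 2 * κ * y := by fun_prop
    unfold accel rate
    exact ((contDiffOn_id).mul (ContDiffOn.div (by fun_prop) hcoeff.contDiffOn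
      fun y hy ↦ (h.coeff_pos hy).ne')).sub (ContDiffOn.div (by fun_prop)
        (hcoeff.pow 2).contDiffOn fun y hy ↦ (pow_pos (h.coeff_pos hy) 2).ne')
  have hK' (_ : ℝ) : LipschitzOnWith (K * 1) (fun z : ℝ × ℝ ↦ accel m p κ z.1)
      (Icc 0 m ×ˢ univ) :=
    hK.comp LipschitzWith.prod_fst.lipschitzOnWith fun z hz ↦ hz.1
  have haccel (x : ℝ) : deriv (deriv y) x = accel m p κ (y x) := by
    refine mul_left_cancel₀ (h.coeff_pos (hmem x)).ne' ?_
    linear_combination hy.second_order x - h.coeff_mul_accel (hmem x) (hy.first_order x)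
  refine ⟨x₀, congrFun <| eq_of_hasDerivAt_hasDerivAt continuous_const hK'
    (hasDerivAt_of_contDiff_two hy.contDiff)
    (fun x ↦ haccel x ▸ hasDerivAt_deriv_of_contDiff_two hy.contDiff x)
    (fun x ↦ ⟨hmem x, trivial⟩)
    (fun x ↦ (h.hasDerivAt_profile (x - x₀)).comp_sub_const x x₀)
    (fun x ↦ (h.hasDerivAt_profileDeriv (x - x₀)).comp_sub_const x x₀)
    (fun x ↦ ⟨h.profile_mem_Icc (x - x₀), trivial⟩) (t₀ := x₀) ?_ ?_⟩
  · rw [hx₀, sub_self, h.profile_zero]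
  · rw [hderiv, sub_self, profileDeriv_zero]

end IsProfileSol

/-! ### The intensity profile `η` -/

section IntensityProfile

variable {c κ : ℝ}

theorem admissible_of_mem_D₁_union_D₂ (h : (c, κ) ∈ D₁ ∪ D₂) :
    Admissible (1 - c ^ 2 / 2) (1 - 2 * κ) κ := by
  have hc : c ^ 2 < 2 := by
    have hc' : 0 ≤ c ∧ c < √2 := by rcases h with h | h <;> exact ⟨h.1, h.2.1⟩
    exact (lt_sqrt hc'.1).1 hc'.2
  have hκ : κ < 1 / 2 := by
    rcases h with ⟨-, -, -, hκ⟩ | ⟨-, -, hκ⟩ <;> simp only at hκ <;> linarith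
  refine ⟨by linarith, by linarith, ?_⟩
  rcases le_total κ 0 <;> nlinarith [sq_nonneg c]

theorem admissible_of_mem_D₃ (h : (c, κ) ∈ D₃) :
    Admissible (-(1 - c ^ 2 / 2)) (-(1 - 2 * κ)) κ := by
  have hκ : 1 / 2 < κ := h.2
  have hc : 2 < c ^ 2 := (sqrt_lt' ((sqrt_nonneg 2).trans_lt h.1)).1 h.1
  exact ⟨by linarith, by linarith, by nlinarith⟩

theorem mem_D_of_admissible {s : ℝ} (hc : 0 ≤ c) (hs : s = 1 ∨ s = -1)
    (h : Admissible (s * (1 - c ^ 2 / 2)) (s * (1 - 2 * κ)) κ) : (c, κ) ∈ D := by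
  have hm := h.m_pos
  have hp := h.p_pos
  rcases hs with rfl | rfl
  · have hc' : c < √2 := (lt_sqrt hc).2 (by linarith)
    rcases le_or_gt κ 0 with hκ | hκ
    · exact .inl (.inr ⟨hc, hc', hκ⟩)
    · exact .inl (.inl ⟨hc, hc', hκ, show κ < 1 / 2 by linarith⟩)
  · have hc' : 0 < c := hc.lt_of_ne' fun h₀ ↦ by norm_num [h₀] at hm
    exact .inr ⟨(sqrt_lt' hc').2 (by linarith), show 1 / 2 < κ by linarith⟩

theorem funF_mul_eq_profileTime {s : ℝ} (hs : s * s = 1)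
    (h : Admissible (s * (1 - c ^ 2 / 2)) (s * (1 - 2 * κ)) κ) (hκ : 0 < κ) (y : ℝ) :
    funF c κ (s * y) = profileTime (s * (1 - c ^ 2 / 2)) (s * (1 - 2 * κ)) κ y := by
  have hs₀ : s ≠ 0 := left_ne_zero_of_mul_eq_one hs
  have hnum : 2 - c ^ 2 - 2 * (s * y) = s * (2 * (s * (1 - c ^ 2 / 2)) - 2 * y) := by
    linear_combination (c ^ 2 - 2) * hs
  have hden : 1 - 2 * κ + 2 * κ * (s * y) = s * (s * (1 - 2 * κ) + 2 * κ * y) := by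
    linear_combination (2 * κ - 1) * hs
  rw [h.profileTime_eq, timeCorrection, if_pos hκ, funF, rate, hnum, hden,
    mul_div_mul_left _ _ hs₀]
  congr 3
  · rw [show 2 * (s * (1 - c ^ 2 / 2)) = s * (2 - c ^ 2) by ring, mul_div_mul_left _ _ hs₀]
  · rw [show 2 * (s * (1 - c ^ 2 / 2)) = s * (2 - c ^ 2) by ring]
    congr 2 <;> ring

theorem funG_eq_profileTime (h : (c, κ) ∈ D₂) :
    funG c κ = profileTime (1 - c ^ 2 / 2) (1 - 2 * κ) κ := by
  ext y
  rw [(admissible_of_mem_D₁_union_D₂ (.inr h)).profileTime_eq, timeCorrection,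
    if_neg h.2.2.not_gt, funG, rate, show 2 * (1 - c ^ 2 / 2) = 2 - c ^ 2 by ring]

theorem funF_eq_profileTime (h : (c, κ) ∈ D₁) :
    funF c κ = profileTime (1 - c ^ 2 / 2) (1 - 2 * κ) κ := by
  ext y
  simpa using funF_mul_eq_profileTime (mul_one 1)
    (by simpa using admissible_of_mem_D₁_union_D₂ (.inl h)) h.2.2.1 y

theorem funH_eq_profileTime_comp_neg (h : (c, κ) ∈ D₃) :
    funH c κ = profileTime (-(1 - c ^ 2 / 2)) (-(1 - 2 * κ)) κ ∘ Neg.neg := by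
  ext y
  have hκ : 0 < κ := one_half_pos.trans h.2
  simpa [funH] using funF_mul_eq_profileTime (c := c) (s := -1) (by norm_num)
    (by simpa using admissible_of_mem_D₃ h) hκ (-y)

theorem bijOn_funF (h : (c, κ) ∈ D₁) : BijOn (funF c κ) (intervalI c) (Ici 0) := by
  rw [funF_eq_profileTime h]
  exact (admissible_of_mem_D₁_union_D₂ (.inl h)).bijOn_profileTime

theorem bijOn_funG (h : (c, κ) ∈ D₂) : BijOn (funG c κ) (intervalI c) (Ici 0) := by
  rw [funG_eq_profileTime h]
  exact (admissible_of_mem_D₁_union_D₂ (.inr h)).bijOn_profileTime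

theorem bijOn_funH (h : (c, κ) ∈ D₃) : BijOn (funH c κ) (intervalJ c) (Ici 0) := by
  have hneg : BijOn Neg.neg (intervalJ c) (Ioc 0 (-(1 - c ^ 2 / 2))) := by
    simpa [intervalJ] using neg_injective.injOn.bijOn_image (s := intervalJ c)
  rw [funH_eq_profileTime_comp_neg h]
  exact (admissible_of_mem_D₃ h).bijOn_profileTime.comp hneg

theorem eta_of_mem_D₁_union_D₂ (h : (c, κ) ∈ D₁ ∪ D₂) :
    eta c κ = profile (1 - c ^ 2 / 2) (1 - 2 * κ) κ := by
  by_cases h₁ : (c, κ) ∈ D₁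
  · rw [eta, if_pos h₁, funF_eq_profileTime h₁]
    rfl
  · have h₂ := h.resolve_left h₁
    rw [eta, if_neg h₁, if_pos h₂, funG_eq_profileTime h₂]
    rfl

theorem eta_of_mem_D₃ (h : (c, κ) ∈ D₃) :
    eta c κ = fun x ↦ -profile (-(1 - c ^ 2 / 2)) (-(1 - 2 * κ)) κ x := by
  have hadm := admissible_of_mem_D₃ h
  have h₁ : (c, κ) ∉ D₁ := fun h' ↦ lt_asymm h'.2.1 h.1
  have h₂ : (c, κ) ∉ D₂ := fun h' ↦ lt_asymm h'.2.1 h.1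
  ext x
  have hmem := hadm.profile_mem x
  set y := profile (-(1 - c ^ 2 / 2)) (-(1 - 2 * κ)) κ x with hy
  have hyJ : -y ∈ intervalJ c := ⟨le_neg.1 hmem.2, neg_lt_zero.2 hmem.1⟩
  have htime : funH c κ (-y) = |x| := by
    rw [funH_eq_profileTime_comp_neg h, Function.comp_apply, neg_neg, hy, hadm.profileTime_profile]
  rw [eta, if_neg h₁, if_neg h₂, evenInverse, ← htime]
  exact (bijOn_funH h).injOn.leftInvOn_invFunOn hyJ

theorem exists_sign_of_mem_D (h : (c, κ) ∈ D) : ∃ s : ℝ, (s = 1 ∨ s = -1) ∧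
    Admissible (s * (1 - c ^ 2 / 2)) (s * (1 - 2 * κ)) κ ∧
    eta c κ = fun x ↦ s * profile (s * (1 - c ^ 2 / 2)) (s * (1 - 2 * κ)) κ x := by
  rcases h with h | h
  · exact ⟨1, .inl rfl, by simpa using admissible_of_mem_D₁_union_D₂ h,
      by simpa using eta_of_mem_D₁_union_D₂ h⟩
  · exact ⟨-1, .inr rfl, by simpa using admissible_of_mem_D₃ h, by simpa using eta_of_mem_D₃ h⟩

theorem isProfileSol_eta (h : (c, κ) ∈ D) :
    IsProfileSol (1 - c ^ 2 / 2) (1 - 2 * κ) κ (eta c κ) := by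
  obtain ⟨s, hs, hadm, heta⟩ := exists_sign_of_mem_D h
  have hss : s * s = 1 := by rcases hs with rfl | rfl <;> norm_num
  simpa only [← mul_assoc, hss, one_mul, ← heta] using hadm.isProfileSol_profile.const_mul s

theorem eta_zero (h : (c, κ) ∈ D) : eta c κ 0 = 1 - c ^ 2 / 2 := by
  obtain ⟨s, hs, hadm, heta⟩ := exists_sign_of_mem_D h
  simp only [heta, hadm.profile_zero]
  rcases hs with rfl | rfl <;> ring

theorem eta_neg (c κ x : ℝ) : eta c κ (-x) = eta c κ x := by
  unfold eta
  split_ifs <;> simp [evenInverse]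

theorem exists_isBigOToOrder_eta (h : (c, κ) ∈ D) :
    ∃ C > 0, ∀ n, IsBigOToOrder n (fun x ↦ exp (-C * |x|)) (eta c κ) := by
  obtain ⟨s, -, hadm, heta⟩ := exists_sign_of_mem_D h
  obtain ⟨C, hC, hprofile⟩ := hadm.exists_isBigOToOrder_profile
  exact ⟨C, hC, fun n ↦ heta ▸ (hprofile n).const_mul s⟩

theorem contDiff_eta (h : (c, κ) ∈ D) : ContDiff ℝ (⊤ : ℕ∞) (eta c κ) := by
  obtain ⟨_, -, heta⟩ := exists_isBigOToOrder_eta h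
  exact contDiff_infty.2 fun n ↦ (heta n).1

theorem eta_pos (h : (c, κ) ∈ D₁ ∪ D₂) (x : ℝ) : 0 < eta c κ x := by
  rw [eta_of_mem_D₁_union_D₂ h]
  exact ((admissible_of_mem_D₁_union_D₂ h).profile_mem x).1

theorem eta_lt_zero (h : (c, κ) ∈ D₃) (x : ℝ) : eta c κ x < 0 := by
  rw [eta_of_mem_D₃ h, neg_lt_zero]
  exact ((admissible_of_mem_D₃ h).profile_mem x).1

theorem deriv_eta_lt_zero (h : (c, κ) ∈ D₁ ∪ D₂) {x : ℝ} (hx : 0 < x) : deriv (eta c κ) x < 0 := by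
  rw [eta_of_mem_D₁_union_D₂ h]
  exact (admissible_of_mem_D₁_union_D₂ h).deriv_profile_neg hx

theorem deriv_eta_pos (h : (c, κ) ∈ D₃) {x : ℝ} (hx : 0 < x) : 0 < deriv (eta c κ) x := by
  rw [eta_of_mem_D₃ h, deriv.fun_neg, neg_pos]
  exact (admissible_of_mem_D₃ h).deriv_profile_neg hx

theorem isExtrOn_eta (h : (c, κ) ∈ D) : IsExtrOn (eta c κ) univ 0 := by
  rcases h with h | h
  · rw [eta_of_mem_D₁_union_D₂ h]
    exact .inr (isMaxOn_iff.2 fun x _ ↦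
      (admissible_of_mem_D₁_union_D₂ h).profile_le_profile_zero x)
  · rw [eta_of_mem_D₃ h]
    exact .inl (isMinOn_iff.2 fun x _ ↦
      neg_le_neg ((admissible_of_mem_D₃ h).profile_le_profile_zero x))

theorem eta_lt_one (h : (c, κ) ∈ D) (hc : 0 < c) (x : ℝ) : eta c κ x < 1 := by
  have hc2 : 0 < c ^ 2 := pow_pos hc 2
  rcases h with h | h
  · rw [eta_of_mem_D₁_union_D₂ h]
    linarith [((admissible_of_mem_D₁_union_D₂ h).profile_mem x).2]
  · exact (eta_lt_zero h x).trans one_pos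

end IntensityProfile

/-! ### Intensity of a solution -/

theorem isWeakDeriv_deriv {u : ℝ → ℂ} (hu : ContDiff ℝ 1 u) : IsWeakDeriv u (deriv u) := by
  intro φ hφ hc
  have hφ₁ : ContDiff ℝ 1 φ := hφ.of_le (by exact_mod_cast le_top)
  have hφu (x : ℝ) : HasDerivAt (fun x ↦ φ x • u x) (φ x • deriv u x + deriv φ x • u x) x :=
    (hφ₁.differentiable one_ne_zero x).hasDerivAt.smul
      (hu.differentiable one_ne_zero x).hasDerivAt
  have int_smul_deriv : Integrable fun x ↦ φ x • deriv u x :=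
    (hφ.continuous.smul (hu.continuous_deriv le_rfl)).integrable_of_hasCompactSupport
      hc.smul_right
  have int_deriv_smul : Integrable fun x ↦ deriv φ x • u x :=
    ((hφ₁.continuous_deriv le_rfl).smul hu.continuous).integrable_of_hasCompactSupport
      hc.deriv.smul_right
  have int_smul : Integrable fun x ↦ φ x • u x :=
    (hφ.continuous.smul hu.continuous).integrable_of_hasCompactSupport hc.smul_right
  have by_parts :=
    integral_eq_zero_of_hasDerivAt_of_integrable hφu (int_smul_deriv.add int_deriv_smul) int_smul
  rw [integral_add int_smul_deriv int_deriv_smul] at by_parts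
  exact eq_neg_of_add_eq_zero_right by_parts

theorem memLp_deriv_of_mem_energySpace {u : ℝ → ℂ} (hu : ContDiff ℝ 1 u)
    (h : u ∈ energySpace) : MemLp (deriv u) 2 := by
  obtain ⟨-, -, w, hw, hw₂⟩ := h
  refine hw₂.ae_eq (ae_eq_of_integral_contDiff_smul_eq (hw₂.locallyIntegrable (by norm_num))
    (hu.continuous_deriv le_rfl).locallyIntegrable fun φ hφ hc ↦ neg_injective ?_)
  rw [← hw φ hφ hc, isWeakDeriv_deriv hu φ hφ hc]

/-- The intensity profile `1 - |u|²` of a wave `u`. -/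
def intensity (u : ℝ → ℂ) (x : ℝ) : ℝ := 1 - ‖u x‖ ^ 2

/-- The product `ū u'`, which is the derivative of `-η / 2` plus `i` times the momentum
density of `u`. -/
def current (u : ℝ → ℂ) (x : ℝ) : ℂ := conj (u x) * deriv u x

theorem twEquation_iff {c κ : ℝ} {u : ℝ → ℂ} : TWEquation c κ u ↔ ∀ x, deriv (deriv u) x =
    -(Complex.I * c * deriv u x
      + ((intensity u x + κ * deriv (deriv (intensity u)) x : ℝ) : ℂ) * u x) := by
  refine forall_congr' fun x ↦ ?_
  rw [eq_neg_iff_add_eq_zero]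
  change _ + _ + u x * ((intensity u x : ℝ) : ℂ)
    + κ * u x * ((deriv (deriv (intensity u)) x : ℝ) : ℂ) = 0 ↔ _
  push_cast
  ring_nf

theorem norm_sq_eq_one_sub_intensity (u : ℝ → ℂ) (x : ℝ) : ‖u x‖ ^ 2 = 1 - intensity u x :=
  (sub_sub_self _ _).symm

theorem intensity_le_one (u : ℝ → ℂ) (x : ℝ) : intensity u x ≤ 1 :=
  sub_le_self _ (sq_nonneg _)

theorem abs_sqrt_two_sub_sub_sqrt_two_le {a : ℝ} (ha : a ≤ 2) : |√(2 - a) - √2| ≤ |a| := by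
  have conjugate : (√(2 - a) - √2) * (√(2 - a) + √2) = -a := by
    linear_combination sq_sqrt (sub_nonneg.2 ha) - sq_sqrt (zero_le_two (α := ℝ))
  have one_le : 1 ≤ √(2 - a) + √2 :=
    one_lt_sqrt_two.le.trans (le_add_of_nonneg_left (sqrt_nonneg _))
  rw [← abs_neg a, ← conjugate, abs_mul]
  exact le_mul_of_one_le_right (abs_nonneg _) (one_le.trans (le_abs_self _))

theorem norm_current (u : ℝ → ℂ) (x : ℝ) : ‖current u x‖ = ‖u x‖ * ‖deriv u x‖ := by
  rw [current, norm_mul, RCLike.norm_conj]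

theorem hasDerivAt_re {f : ℝ → ℂ} {f' : ℂ} {x : ℝ} (hf : HasDerivAt f f' x) :
    HasDerivAt (fun x ↦ (f x).re) f'.re x :=
  Complex.reCLM.hasFDerivAt.comp_hasDerivAt x hf

theorem hasDerivAt_im {f : ℝ → ℂ} {f' : ℂ} {x : ℝ} (hf : HasDerivAt f f' x) :
    HasDerivAt (fun x ↦ (f x).im) f'.im x :=
  Complex.imCLM.hasFDerivAt.comp_hasDerivAt x hf

section ContDiffTwo

variable {u : ℝ → ℂ} (hu : ContDiff ℝ 2 u)
include hu

theorem contDiff_intensity : ContDiff ℝ 2 (intensity u) :=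
  contDiff_const.sub (hu.norm_sq ℝ)

theorem continuous_current : Continuous (current u) :=
  (Complex.continuous_conj.comp hu.continuous).mul (contDiff_one_deriv hu).continuous

theorem hasDerivAt_intensity (x : ℝ) :
    HasDerivAt (intensity u) (-2 * (current u x).re) x := by
  refine ((hasDerivAt_of_contDiff_two hu x).norm_sq.const_sub 1).congr_deriv ?_
  rw [Complex.inner, current, mul_comm (deriv u x), neg_mul]

theorem deriv_intensity : deriv (intensity u) = fun x ↦ -2 * (current u x).re :=
  funext fun x ↦ (hasDerivAt_intensity hu x).deriv

theorem hasDerivAt_current (x : ℝ) : HasDerivAt (current u)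
    (((‖deriv u x‖ ^ 2 : ℝ) : ℂ) + conj (u x) * deriv (deriv u) x) x := by
  refine ((hasDerivAt_of_contDiff_two hu x).star.mul
    (hasDerivAt_deriv_of_contDiff_two hu x)).congr_deriv ?_
  rw [Complex.ofReal_pow, ← Complex.conj_mul']
  rfl

theorem deriv_deriv_intensity (x : ℝ) : deriv (deriv (intensity u)) x =
    -2 * (‖deriv u x‖ ^ 2 + (conj (u x) * deriv (deriv u) x).re) := by
  rw [deriv_intensity hu, ← Complex.ofReal_re (‖deriv u x‖ ^ 2), ← Complex.add_re]
  exact ((hasDerivAt_re (hasDerivAt_current hu x)).const_mul (-2)).deriv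

theorem one_sub_intensity_mul_norm_deriv_sq (x : ℝ) : (1 - intensity u x) * ‖deriv u x‖ ^ 2
    = (deriv (intensity u) x / 2) ^ 2 + (current u x).im ^ 2 := by
  rw [← norm_sq_eq_one_sub_intensity, ← mul_pow, ← norm_current, Complex.sq_norm,
    Complex.normSq_apply, deriv_intensity hu]
  ring

end ContDiffTwo

namespace IsSmoothSol

variable {c κ : ℝ} {u : ℝ → ℂ} (h : IsSmoothSol c κ u)
include h

theorem memLp_deriv : MemLp (deriv u) 2 :=
  memLp_deriv_of_mem_energySpace (h.1.of_le one_le_two) h.2.1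

theorem memLp_intensity : MemLp (intensity u) 2 :=
  h.2.1.2.1

theorem tendsto_intensity : Tendsto (intensity u) (cocompact ℝ) (𝓝 0) := by
  set r : ℝ → ℝ := fun x ↦ √(2 - intensity u x)
  have sq_r (x : ℝ) : r x ^ 2 = 1 + ‖u x‖ ^ 2 := by
    rw [norm_sq_eq_one_sub_intensity, sq_sqrt (by linarith [intensity_le_one u x])]
    ring
  have r_pos (x : ℝ) : 0 < r x := sqrt_pos.2 (by linarith [intensity_le_one u x])
  have hr (x : ℝ) : HasDerivAt (fun x ↦ r x - √2) ((current u x).re / r x) x := by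
    refine ((((hasDerivAt_intensity h.1 x).const_sub 2).sqrt (sqrt_pos.1 (r_pos x)).ne').sub_const
      _).congr_deriv ?_
    rw [neg_mul, neg_neg, mul_div_mul_left _ _ two_ne_zero]
  have cont_r : Continuous r := (continuous_const.sub (contDiff_intensity h.1).continuous).sqrt
  have deriv_le (x : ℝ) : ‖(current u x).re / r x‖ ≤ ‖deriv u x‖ := by
    have norm_le : ‖u x‖ ≤ r x :=
      le_of_sq_le_sq (by linarith [sq_r x]) (r_pos x).le
    rw [norm_div, norm_of_nonneg (r_pos x).le, div_le_iff₀' (r_pos x)]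
    calc |(current u x).re| ≤ ‖u x‖ * ‖deriv u x‖ :=
          norm_current u x ▸ Complex.abs_re_le_norm _
      _ ≤ r x * ‖deriv u x‖ := by gcongr
  have tendsto_r := tendsto_zero_of_memLp_two hr
    (h.memLp_intensity.mono (cont_r.sub continuous_const).aestronglyMeasurable
      (.of_forall fun x ↦
        abs_sqrt_two_sub_sub_sqrt_two_le ((intensity_le_one u x).trans one_le_two)))
    (h.memLp_deriv.mono ((Complex.continuous_re.comp (continuous_current h.1)).div cont_r
      fun x ↦ (r_pos x).ne').aestronglyMeasurable (.of_forall deriv_le))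
  have hη : intensity u = fun x ↦ 2 - (r x - √2 + √2) ^ 2 := funext fun x ↦ by
    rw [sub_add_cancel, sq_r, norm_sq_eq_one_sub_intensity]
    ring
  rw [hη]
  simpa using ((tendsto_r.add_const √2).pow 2).const_sub 2

theorem exists_norm_le : ∃ B, ∀ x, ‖u x‖ ≤ B := by
  let η : ZeroAtInftyContinuousMap ℝ ℝ :=
    ⟨⟨intensity u, (contDiff_intensity h.1).continuous⟩, h.tendsto_intensity⟩
  obtain ⟨B, hB⟩ := η.isBounded_range.exists_norm_le
  refine ⟨√(1 + B), fun x ↦ le_sqrt_of_sq_le ?_⟩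
  rw [norm_sq_eq_one_sub_intensity]
  linarith [neg_le_of_abs_le (hB _ (mem_range_self x) : |intensity u x| ≤ B)]

theorem memLp_current : MemLp (current u) 2 := by
  obtain ⟨B, hB⟩ := h.exists_norm_le
  refine h.memLp_deriv.of_le_mul (c := B) (continuous_current h.1).aestronglyMeasurable
    (.of_forall fun x ↦ ?_)
  rw [norm_current]
  exact mul_le_mul_of_nonneg_right (hB x) (norm_nonneg _)

theorem conj_mul_deriv_deriv (x : ℝ) : conj (u x) * deriv (deriv u) x =
    -(Complex.I * c * current u x
      + (((intensity u x + κ * deriv (deriv (intensity u)) x) * ‖u x‖ ^ 2 : ℝ) : ℂ)) := by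
  rw [twEquation_iff.1 h.2.2 x, current, Complex.ofReal_mul _ (‖u x‖ ^ 2), Complex.ofReal_pow,
    ← Complex.conj_mul']
  ring

theorem current_im (x : ℝ) : (current u x).im = c / 2 * intensity u x := by
  refine sub_eq_zero.1 (eq_zero_of_hasDerivAt_zero_of_memLp two_ne_zero ENNReal.ofNat_ne_top
    (fun x ↦ ?_) (h.memLp_current.im.sub (h.memLp_intensity.const_mul (c / 2))) x)
  refine ((hasDerivAt_im (hasDerivAt_current h.1 x)).sub
    ((hasDerivAt_intensity h.1 x).const_mul (c / 2))).congr_deriv ?_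
  rw [h.conj_mul_deriv_deriv]
  simp only [Complex.add_im, Complex.neg_im, Complex.mul_im, Complex.mul_re, Complex.I_re,
    Complex.I_im, Complex.ofReal_re, Complex.ofReal_im]
  ring

theorem norm_deriv_sq (x : ℝ) :
    ‖deriv u x‖ ^ 2 = intensity u x ^ 2 / 2 + κ * deriv (intensity u) x ^ 2 / 2 := by
  have hη := contDiff_intensity h.1
  have memLp_deriv_intensity : MemLp (deriv (intensity u)) 2 := by
    rw [deriv_intensity h.1]
    exact h.memLp_current.re.const_mul (-2)
  have integrable : MemLp (fun x ↦ ‖deriv u x‖ ^ 2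
      - (intensity u x ^ 2 / 2 + κ * deriv (intensity u) x ^ 2 / 2)) 1 :=
    memLp_one_iff_integrable.2 (h.memLp_deriv.norm.integrable_sq.sub
      ((h.memLp_intensity.integrable_sq.div_const 2).add
        ((memLp_deriv_intensity.integrable_sq.const_mul κ).div_const 2)))
  refine sub_eq_zero.1 (eq_zero_of_hasDerivAt_zero_of_memLp one_ne_zero ENNReal.one_ne_top
    (fun x ↦ ?_) integrable x)
  refine ((hasDerivAt_deriv_of_contDiff_two h.1 x).norm_sq.sub
    ((((hasDerivAt_intensity h.1 x).fun_pow 2).div_const 2).add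
      ((((hasDerivAt_deriv_of_contDiff_two hη x).fun_pow 2).const_mul κ).div_const
        2))).congr_deriv ?_
  have inner_deriv_deriv : inner ℝ (deriv u x) (deriv (deriv u) x)
      = -(intensity u x + κ * deriv (deriv (intensity u)) x) * (current u x).re := by
    rw [twEquation_iff.1 h.2.2 x, current, Complex.inner]
    simp only [Complex.mul_im, Complex.neg_re, Complex.neg_im, Complex.add_re, Complex.add_im,
      Complex.mul_re, Complex.conj_re, Complex.conj_im, Complex.I_re, Complex.I_im,
      Complex.ofReal_re, Complex.ofReal_im]
    ring
  linear_combination 2 * inner_deriv_deriv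
    - κ * deriv (deriv (intensity u)) x * congrFun (deriv_intensity h.1) x

theorem isProfileSol_intensity :
    IsProfileSol (1 - c ^ 2 / 2) (1 - 2 * κ) κ (intensity u) := by
  refine ⟨contDiff_intensity h.1, fun x ↦ ?_, fun x ↦ ?_⟩
  · have norm_sq := one_sub_intensity_mul_norm_deriv_sq h.1 x
    rw [h.current_im, h.norm_deriv_sq] at norm_sq
    linear_combination -4 * norm_sq
  · have re_conj_mul : (conj (u x) * deriv (deriv u) x).re
        = c * (current u x).im
          - (intensity u x + κ * deriv (deriv (intensity u)) x) * ‖u x‖ ^ 2 := by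
      rw [h.conj_mul_deriv_deriv]
      simp only [Complex.neg_re, Complex.add_re, Complex.mul_re, Complex.mul_im, Complex.I_re,
        Complex.I_im, Complex.ofReal_re, Complex.ofReal_im]
      ring
    have hη'' := deriv_deriv_intensity h.1 x
    rw [re_conj_mul, h.current_im, h.norm_deriv_sq, norm_sq_eq_one_sub_intensity] at hη''
    linear_combination hη''

theorem isTrivial_of_intensity_eq_zero (h₀ : intensity u = 0) : IsTrivial u := by
  have deriv_eq_zero (x : ℝ) : deriv u x = 0 := by
    simpa [h₀] using h.norm_deriv_sq x
  have norm_eq_one : ‖u 0‖ = 1 := by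
    rw [← pow_eq_one_iff_of_nonneg (norm_nonneg _) two_ne_zero, norm_sq_eq_one_sub_intensity, h₀,
      Pi.zero_apply, sub_zero]
  obtain ⟨φ, hφ⟩ := (Complex.norm_eq_one_iff _).1 norm_eq_one
  exact ⟨φ, fun x ↦ hφ ▸ is_const_of_deriv_eq_zero (h.1.differentiable two_ne_zero)
    deriv_eq_zero x 0⟩

end IsSmoothSol

/-! ### Nonexistence and uniqueness -/

theorem exists_eq_exp_mul_I_mul {z w : ℂ} (h : ‖w‖ = ‖z‖) :
    ∃ φ : ℝ, w = Complex.exp (φ * Complex.I) * z := by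
  refine ⟨w.arg - z.arg, ?_⟩
  calc w = ‖w‖ * Complex.exp (w.arg * Complex.I) := w.norm_mul_exp_arg_mul_I.symm
    _ = Complex.exp ((w.arg - z.arg : ℝ) * Complex.I)
          * (‖z‖ * Complex.exp (z.arg * Complex.I)) := by
      rw [h, mul_left_comm, ← Complex.exp_add, ← add_mul, ← Complex.ofReal_add, sub_add_cancel]
    _ = _ := by rw [z.norm_mul_exp_arg_mul_I]

theorem exists_common_phase {z z' w w' : ℂ} (h : ‖w‖ = ‖z‖) (h' : ‖w'‖ = ‖z'‖)
    (hconj : conj w * w' = conj z * z') :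
    ∃ φ : ℝ, w = Complex.exp (φ * Complex.I) * z ∧ w' = Complex.exp (φ * Complex.I) * z' := by
  rcases eq_or_ne z 0 with rfl | hz
  · obtain ⟨φ, hφ⟩ := exists_eq_exp_mul_I_mul h'
    exact ⟨φ, by simpa using h, hφ⟩
  · obtain ⟨φ, hφ⟩ := exists_eq_exp_mul_I_mul h
    have hw : w ≠ 0 := norm_ne_zero_iff.1 (h ▸ norm_ne_zero_iff.2 hz)
    refine ⟨φ, hφ, mul_left_cancel₀ ((map_ne_zero conj).2 hw) ?_⟩
    rw [hconj, hφ, map_mul, mul_mul_mul_comm, Complex.conj_mul', Complex.norm_exp_ofReal_mul_I,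
      Complex.ofReal_one, one_pow, one_mul]

namespace IsSmoothSol

variable {c κ : ℝ} {u v : ℝ → ℂ}

theorem exists_phase_eq_at (hv : IsSmoothSol c κ v) (hu : IsSmoothSol c κ u) {x y : ℝ}
    (h : intensity v x = intensity u y) (h' : deriv (intensity v) x = deriv (intensity u) y) :
    ∃ φ : ℝ, v x = Complex.exp (φ * Complex.I) * u y ∧
      deriv v x = Complex.exp (φ * Complex.I) * deriv u y := by
  refine exists_common_phase ?_ ?_ (Complex.ext (?_ : (current v x).re = (current u y).re)
    (?_ : (current v x).im = (current u y).im))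
  · rw [← sq_eq_sq₀ (norm_nonneg _) (norm_nonneg _), norm_sq_eq_one_sub_intensity,
      norm_sq_eq_one_sub_intensity, h]
  · rw [← sq_eq_sq₀ (norm_nonneg _) (norm_nonneg _), hv.norm_deriv_sq, hu.norm_deriv_sq, h, h']
  · rw [deriv_intensity hv.1, deriv_intensity hu.1] at h'
    linarith
  · rw [hv.current_im, hu.current_im, h]

theorem exists_eq_exp_mul_comp_sub (hv : IsSmoothSol c κ v) (hu : IsSmoothSol c κ u) {x₀ : ℝ}
    (h : ∀ x, intensity v x = intensity u (x - x₀)) :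
    ∃ φ : ℝ, ∀ x, v x = Complex.exp (φ * Complex.I) * u (x - x₀) := by
  have hderiv : deriv (intensity v) = fun x ↦ deriv (intensity u) (x - x₀) := by
    rw [funext h]
    exact funext (deriv_comp_sub_const _ _)
  have hderiv' : deriv (deriv (intensity v)) = fun x ↦ deriv (deriv (intensity u)) (x - x₀) := by
    rw [hderiv]
    exact funext (deriv_comp_sub_const _ _)
  obtain ⟨φ, hφ, hφ'⟩ := hv.exists_phase_eq_at hu (h x₀) (congrFun hderiv x₀)
  let q (x : ℝ) : ℂ := (intensity v x + κ * deriv (deriv (intensity v)) x : ℝ)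
  let L (x : ℝ) : ℂ × ℂ →L[ℂ] ℂ :=
    -((Complex.I * c) • ContinuousLinearMap.snd ℂ ℂ ℂ + q x • ContinuousLinearMap.fst ℂ ℂ ℂ)
  have continuous_L : Continuous L := by
    have hη := contDiff_intensity hv.1
    have := hη.continuous
    have := (contDiff_one_deriv hη).continuous_deriv le_rfl
    fun_prop
  refine ⟨φ, congrFun <| eq_of_hasDerivAt_hasDerivAt continuous_L.nnnorm
    (fun x ↦ (L x).lipschitz.lipschitzOnWith (s := univ)) (t₀ := x₀)
    (hasDerivAt_of_contDiff_two hv.1)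
    (fun x ↦ (hasDerivAt_deriv_of_contDiff_two hv.1 x).congr_deriv (twEquation_iff.1 hv.2.2 x))
    (fun _ ↦ trivial)
    (fun x ↦ ((hasDerivAt_of_contDiff_two hu.1 _).comp_sub_const x x₀).const_mul _)
    (fun x ↦ (((hasDerivAt_deriv_of_contDiff_two hu.1 _).comp_sub_const x x₀).const_mul
      _).congr_deriv ?_)
    (fun _ ↦ trivial) hφ hφ'⟩
  rw [twEquation_iff.1 hu.2.2 (x - x₀), ← h, ← congrFun hderiv' x]
  simp only [Complex.ofReal_add, Complex.ofReal_mul, neg_add_rev, add_apply, neg_apply,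
    smul_apply, ContinuousLinearMap.coe_fst', smul_eq_mul, ContinuousLinearMap.coe_snd', L, q]
  ring

theorem exists_eq_profile (hu : IsSmoothSol c κ u) (hne : ¬ IsTrivial u) :
    ∃ s : ℝ, (s = 1 ∨ s = -1) ∧ Admissible (s * (1 - c ^ 2 / 2)) (s * (1 - 2 * κ)) κ ∧
      ∃ x₀, ∀ x,
        s * intensity u x = profile (s * (1 - c ^ 2 / 2)) (s * (1 - 2 * κ)) κ (x - x₀) := by
  obtain ⟨x₁, hx₁⟩ : ∃ x, intensity u x ≠ 0 := by
    by_contra! hzero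
    exact hne (hu.isTrivial_of_intensity_eq_zero (funext hzero))
  obtain ⟨s, hs, hpos⟩ : ∃ s : ℝ, (s = 1 ∨ s = -1) ∧ 0 < s * intensity u x₁ := by
    rcases hx₁.lt_or_gt with hneg | hpos
    · exact ⟨-1, .inr rfl, by linarith⟩
    · exact ⟨1, .inl rfl, by linarith⟩
  have hsol := hu.isProfileSol_intensity.const_mul s
  have hlim : Tendsto (fun x ↦ s * intensity u x) (cocompact ℝ) (𝓝 0) := by
    simpa using hu.tendsto_intensity.const_mul s
  exact ⟨s, hs, hsol.admissible hlim hpos, hsol.exists_eq_profile hlim hpos⟩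

theorem mem_D (hc : 0 ≤ c) (hu : IsSmoothSol c κ u) (hne : ¬ IsTrivial u) : (c, κ) ∈ D := by
  obtain ⟨s, hs, h, -⟩ := hu.exists_eq_profile hne
  exact mem_D_of_admissible hc hs h

theorem exists_intensity_eq_eta (hc : 0 ≤ c) (hu : IsSmoothSol c κ u) (hne : ¬ IsTrivial u) :
    ∃ x₀, ∀ x, intensity u x = eta c κ (x - x₀) := by
  obtain ⟨s, hs, h, x₀, hx₀⟩ := hu.exists_eq_profile hne
  obtain ⟨t, ht, h', heta⟩ := exists_sign_of_mem_D (mem_D_of_admissible hc hs h)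
  have hst : t = s := by
    have := h.m_pos
    have := h'.m_pos
    rcases hs with rfl | rfl <;> rcases ht with rfl | rfl <;> linarith
  subst hst
  have hss : t * t = 1 := by rcases hs with rfl | rfl <;> norm_num
  exact ⟨x₀, fun x ↦ by simp only [heta, ← hx₀, ← mul_assoc, hss, one_mul]⟩

theorem isUniqueNontrivialSol (hc : 0 ≤ c) (h : (c, κ) ∈ D) (hu : IsSmoothSol c κ u)
    (heta : intensity u = eta c κ) : IsUniqueNontrivialSol c κ u := by
  refine ⟨hu, fun ⟨φ, hφ⟩ ↦ ?_, fun v hv hne ↦ ?_⟩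
  · obtain ⟨s, -, hadm, -⟩ := exists_sign_of_mem_D h
    have eta_zero_eq_zero : eta c κ 0 = 0 := by
      rw [← heta, intensity, hφ, Complex.norm_exp_ofReal_mul_I, one_pow, sub_self]
    rw [eta_zero h] at eta_zero_eq_zero
    exact hadm.m_pos.ne' (by rw [eta_zero_eq_zero, mul_zero])
  · obtain ⟨x₀, hx₀⟩ := hv.exists_intensity_eq_eta hc hne
    obtain ⟨φ, hφ⟩ := hv.exists_eq_exp_mul_comp_sub hu (x₀ := x₀) (by rwa [heta])
    exact ⟨x₀, φ, hφ⟩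

end IsSmoothSol

/-! ### Existence -/

section Reconstruction

variable {c κ : ℝ} {u : ℝ → ℂ} (hu : ContDiff ℝ 2 u)
  (hη : IsProfileSol (1 - c ^ 2 / 2) (1 - 2 * κ) κ (intensity u))
  (him : ∀ x, (current u x).im = c / 2 * intensity u x) (hne : Dense {x | u x ≠ 0})
include hu hη him hne

theorem norm_deriv_sq_of_isProfileSol (x : ℝ) :
    ‖deriv u x‖ ^ 2 = intensity u x ^ 2 / 2 + κ * deriv (intensity u) x ^ 2 / 2 := by
  have cont_deriv := (contDiff_one_deriv hu).continuous
  have cont_intensity := hη.contDiff.continuous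
  have cont_deriv_intensity := (contDiff_one_deriv hη.contDiff).continuous
  refine congrFun (Continuous.ext_on hne (f := fun x ↦ ‖deriv u x‖ ^ 2)
    (g := fun x ↦ intensity u x ^ 2 / 2 + κ * deriv (intensity u) x ^ 2 / 2)
    (by fun_prop) (by fun_prop) fun y hy ↦ ?_) x
  have hpos : 0 < 1 - intensity u y := by
    rw [← norm_sq_eq_one_sub_intensity]
    exact pow_pos (norm_pos_iff.2 hy) 2
  refine mul_left_cancel₀ hpos.ne' ?_
  rw [one_sub_intensity_mul_norm_deriv_sq hu, him]
  linear_combination hη.first_order y / 4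

theorem conj_mul_deriv_deriv_of_isProfileSol (x : ℝ) : conj (u x) * deriv (deriv u) x =
    -(Complex.I * c * current u x
      + (((intensity u x + κ * deriv (deriv (intensity u)) x) * ‖u x‖ ^ 2 : ℝ) : ℂ)) := by
  have re_conj_mul := deriv_deriv_intensity hu x
  rw [norm_deriv_sq_of_isProfileSol hu hη him hne] at re_conj_mul
  have im_conj_mul := (hasDerivAt_im (hasDerivAt_current hu x)).deriv
  rw [funext him, deriv_const_mul_field, deriv_intensity hu, Complex.add_im, Complex.ofReal_im,
    zero_add] at im_conj_mul
  generalize conj (u x) * deriv (deriv u) x = z at *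
  rw [norm_sq_eq_one_sub_intensity]
  apply Complex.ext <;>
    simp only [Complex.neg_re, Complex.neg_im, Complex.add_re, Complex.add_im, Complex.mul_re,
      Complex.mul_im, Complex.I_re, Complex.I_im, Complex.ofReal_re, Complex.ofReal_im]
  · rw [him]
    linear_combination (re_conj_mul - hη.second_order x) / 2
  · linear_combination -im_conj_mul

theorem twEquation_of_isProfileSol : TWEquation c κ u := by
  have cont_u := hu.continuous
  have cont_deriv := (contDiff_one_deriv hu).continuous
  have cont_deriv_deriv := (contDiff_one_deriv hu).continuous_deriv le_rfl
  have cont_intensity := hη.contDiff.continuous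
  have cont_deriv_deriv_intensity := (contDiff_one_deriv hη.contDiff).continuous_deriv le_rfl
  refine twEquation_iff.2 fun x ↦ congrFun (Continuous.ext_on hne cont_deriv_deriv
    (g := fun x ↦ -(Complex.I * c * deriv u x
      + ((intensity u x + κ * deriv (deriv (intensity u)) x : ℝ) : ℂ) * u x))
    (by fun_prop) fun y hy ↦ mul_left_cancel₀ ((map_ne_zero conj).2 hy) ?_) x
  rw [conj_mul_deriv_deriv_of_isProfileSol hu hη him hne, current, Complex.ofReal_mul _ (‖u y‖ ^ 2),
    Complex.ofReal_pow, ← Complex.conj_mul']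
  ring

end Reconstruction

theorem deriv_isBigO {κ : ℝ} {u : ℝ → ℂ} {w : ℝ → ℝ} (hη : intensity u =O[⊤] w)
    (hη' : deriv (intensity u) =O[⊤] w) (h : ∀ x,
      ‖deriv u x‖ ^ 2 = intensity u x ^ 2 / 2 + κ * deriv (intensity u) x ^ 2 / 2) :
    deriv u =O[⊤] w := by
  refine (IsBigO.of_pow two_ne_zero (f := fun x ↦ ‖deriv u x‖) ?_).of_norm_left
  have hsum := ((hη.pow 2).const_mul_left (1 / 2)).add ((hη'.pow 2).const_mul_left (κ / 2))
  refine hsum.congr_left fun x ↦ ?_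
  rw [Pi.pow_apply, h]
  ring

theorem memLp_exp_neg_mul_abs {C : ℝ} (hC : 0 < C) :
    MemLp (fun x : ℝ ↦ exp (-C * |x|)) 2 := by
  have continuous_exp : Continuous fun x : ℝ ↦ exp (-C * |x|) := by fun_prop
  have sq_exp : (fun x : ℝ ↦ exp (-C * |x|) ^ 2) = fun x ↦ exp (-(2 * C) * |x|) := by
    ext x
    rw [← exp_nat_mul]
    push_cast
    ring_nf
  rw [memLp_two_iff_integrable_sq continuous_exp.aestronglyMeasurable, sq_exp,
    ← integrableOn_univ, ← Iic_union_Ioi (a := (0 : ℝ))]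
  have hC2 : 0 < 2 * C := by positivity
  refine IntegrableOn.union ?_ ?_
  · refine (integrableOn_exp_mul_Iic hC2 0).congr_fun (fun x hx ↦ ?_) measurableSet_Iic
    simp only [abs_of_nonpos (mem_Iic.1 hx), neg_mul_neg]
  · refine (exp_neg_integrableOn_Ioi 0 hC2).congr_fun (fun x hx ↦ ?_) measurableSet_Ioi
    simp only [abs_of_pos (mem_Ioi.1 hx)]

theorem memLp_of_isBigO_top {E : Type*} [NormedAddCommGroup E] {f : ℝ → E} {w : ℝ → ℝ}
    {p : ENNReal} (hf : Continuous f) (hw : MemLp w p) (h : f =O[⊤] w) : MemLp f p := by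
  obtain ⟨A, hA⟩ := isBigO_top.1 h
  exact hw.of_le_mul hf.aestronglyMeasurable (.of_forall hA)

theorem mem_energySpace_of_memLp {u : ℝ → ℂ} (hu : ContDiff ℝ 1 u) (hη : MemLp (intensity u) 2)
    (hu' : MemLp (deriv u) 2) : u ∈ energySpace := by
  refine ⟨fun K hK ↦ ?_, hη, deriv u, isWeakDeriv_deriv hu, hu'⟩
  have finite : IsFiniteMeasure (volume.restrict K) :=
    isFiniteMeasure_restrict.2 hK.measure_ne_top
  obtain ⟨B, hB⟩ := hK.exists_bound_of_continuousOn hu.continuous.continuousOn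
  exact .of_bound hu.continuous.aestronglyMeasurable B
    ((ae_restrict_iff' hK.measurableSet).2 (.of_forall hB))

theorem isSmoothSol_of_intensity_eq_eta {c κ : ℝ} {u : ℝ → ℂ} (h : (c, κ) ∈ D)
    (hu : ContDiff ℝ 2 u) (hη : intensity u = eta c κ)
    (him : ∀ x, (current u x).im = c / 2 * eta c κ x) (hne : Dense {x | u x ≠ 0}) :
    IsSmoothSol c κ u := by
  have hprofile := isProfileSol_eta h
  obtain ⟨C, hC, hdecay⟩ := exists_isBigOToOrder_eta h
  rw [← hη] at him hprofile hdecay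
  have memLp_of_isBigO {E : Type} [NormedAddCommGroup E] {f : ℝ → E} (hf : Continuous f) :=
    memLp_of_isBigO_top hf (memLp_exp_neg_mul_abs hC)
  exact ⟨hu, mem_energySpace_of_memLp (hu.of_le one_le_two)
    (memLp_of_isBigO hprofile.contDiff.continuous (hdecay 0).isBigO)
    (memLp_of_isBigO (contDiff_one_deriv hu).continuous (deriv_isBigO (hdecay 0).isBigO
      (hdecay 1).deriv.isBigO (norm_deriv_sq_of_isProfileSol hu hprofile him hne))),
    twEquation_of_isProfileSol hu hprofile him hne⟩

theorem IsSmoothSol.exists_isBigOToOrder_deriv {c κ : ℝ} {u : ℝ → ℂ} (hu : IsSmoothSol c κ u)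
    (h : (c, κ) ∈ D) (hη : intensity u = eta c κ) : ∃ C > 0, ∀ n,
      IsBigOToOrder n (fun x ↦ exp (-C * |x|)) (deriv u) ∧
      IsBigOToOrder n (fun x ↦ exp (-C * |x|)) (eta c κ) := by
  obtain ⟨C, hC, hdecay⟩ := exists_isBigOToOrder_eta h
  rw [← hη] at hdecay ⊢
  refine ⟨C, hC, fun n ↦ ⟨?_, hdecay n⟩⟩
  have hu' : deriv u =O[⊤] fun x ↦ exp (-C * |x|) :=
    deriv_isBigO (hdecay 0).isBigO (hdecay 1).deriv.isBigO hu.norm_deriv_sq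
  induction n with
  | zero => exact .of_continuous (contDiff_one_deriv hu.1).continuous hu'
  | succ n ih =>
    have hw := exp_neg_mul_abs_isBigO_one hC.le
    have u_bounded : u =O[⊤] (1 : ℝ → ℝ) := by
      obtain ⟨B, hB⟩ := hu.exists_norm_le
      exact isBigO_top.2 ⟨B, by simpa using hB⟩
    have hu₁ : IsBigOToOrder n 1 u :=
      (IsBigOToOrder.succ (hasDerivAt_of_contDiff_two hu.1) u_bounded
        (ih.trans_isBigO hw)).of_le n.le_succ
    have potential : IsBigOToOrder n (fun x ↦ exp (-C * |x|))
        fun x ↦ ((intensity u x + κ * deriv (deriv (intensity u)) x : ℝ) : ℂ) :=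
      ((hdecay n).add ((hdecay (n + 2)).deriv.deriv.const_mul κ)).ofReal
    refine .succ (hasDerivAt_deriv_of_contDiff_two hu.1) hu' ?_
    have hrhs := ((ih.const_mul (Complex.I * c)).add (potential.mul_bounded hu₁)).const_mul (-1)
    rw [funext (twEquation_iff.1 hu.2.2)]
    exact hrhs.congr fun x ↦ neg_one_mul _

/-! ### The solitons -/

theorem current_im_polar {ρ θ : ℝ → ℝ} {ρ' θ' x : ℝ} (hρ : HasDerivAt ρ ρ' x)
    (hθ : HasDerivAt θ θ' x) :
    (current (fun x ↦ (ρ x : ℂ) * Complex.exp (θ x * Complex.I)) x).im = ρ x ^ 2 * θ' := by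
  have hderiv : HasDerivAt (fun x ↦ (ρ x : ℂ) * Complex.exp (θ x * Complex.I)) _ x :=
    hρ.ofReal_comp.mul (hθ.ofReal_comp.mul_const Complex.I).cexp
  have unimodular : conj (Complex.exp (θ x * Complex.I)) * Complex.exp (θ x * Complex.I) = 1 := by
    rw [Complex.conj_mul', Complex.norm_exp_ofReal_mul_I, Complex.ofReal_one, one_pow]
  have hcurrent : current (fun x ↦ (ρ x : ℂ) * Complex.exp (θ x * Complex.I)) x =
      ((ρ x * ρ' : ℝ) : ℂ) + ((ρ x ^ 2 * θ' : ℝ) : ℂ) * Complex.I := by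
    rw [current, hderiv.deriv, map_mul, Complex.conj_ofReal]
    push_cast
    linear_combination (ρ x * ρ' + ρ x ^ 2 * θ' * Complex.I) * unimodular
  rw [hcurrent, Complex.add_im, Complex.ofReal_im, zero_add, Complex.im_ofReal_mul, Complex.I_im,
    mul_one]

section SolitonPos

variable {c κ : ℝ} (h : (c, κ) ∈ D) (hc : 0 < c)
include h hc

theorem contDiff_eta_div_one_sub_eta :
    ContDiff ℝ (⊤ : ℕ∞) fun x ↦ eta c κ x / (1 - eta c κ x) :=
  (contDiff_eta h).div (contDiff_const.sub (contDiff_eta h))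
    fun x ↦ (sub_pos.2 (eta_lt_one h hc x)).ne'

theorem hasDerivAt_theta (x : ℝ) :
    HasDerivAt (theta c κ) (c / 2 * (eta c κ x / (1 - eta c κ x))) x := by
  have hcont := (contDiff_eta_div_one_sub_eta h hc).continuous
  exact (intervalIntegral.integral_hasDerivAt_right (hcont.intervalIntegrable _ _)
    (hcont.stronglyMeasurableAtFilter _ _) hcont.continuousAt).const_mul (c / 2)

theorem contDiff_solitonPos : ContDiff ℝ 2 (solitonPos c κ) := by
  have eta_contDiff : ContDiff ℝ 2 (eta c κ) := contDiff_infty.1 (contDiff_eta h) 2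
  have theta_contDiff : ContDiff ℝ 2 (theta c κ) :=
    contDiff_two_of_hasDerivAt (hasDerivAt_theta h hc)
      (contDiff_const.mul (contDiff_infty.1 (contDiff_eta_div_one_sub_eta h hc) 1))
  have modulus_contDiff : ContDiff ℝ 2 fun x ↦ √(1 - eta c κ x) :=
    (contDiff_const.sub eta_contDiff).sqrt fun x ↦ (sub_pos.2 (eta_lt_one h hc x)).ne'
  exact (Complex.ofRealCLM.contDiff.comp modulus_contDiff).mul
    ((Complex.ofRealCLM.contDiff.comp theta_contDiff).mul contDiff_const).cexp

theorem intensity_solitonPos : intensity (solitonPos c κ) = eta c κ := by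
  ext x
  rw [intensity, solitonPos, norm_mul, Complex.norm_exp_ofReal_mul_I, mul_one, Complex.norm_real,
    norm_eq_abs, sq_abs, sq_sqrt (sub_pos.2 (eta_lt_one h hc x)).le, sub_sub_self]

theorem isSmoothSol_solitonPos : IsSmoothSol c κ (solitonPos c κ) := by
  have one_sub_pos (x : ℝ) : 0 < 1 - eta c κ x := sub_pos.2 (eta_lt_one h hc x)
  refine isSmoothSol_of_intensity_eq_eta h (contDiff_solitonPos h hc) (intensity_solitonPos h hc)
    (fun x ↦ ?_) ?_
  · have modulus_deriv := ((hasDerivAt_of_contDiff_two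
      (contDiff_infty.1 (contDiff_eta h) 2) x).const_sub 1).sqrt (one_sub_pos x).ne'
    refine (current_im_polar modulus_deriv (hasDerivAt_theta h hc x)).trans ?_
    rw [sq_sqrt (one_sub_pos x).le, mul_left_comm, mul_div_cancel₀ _ (one_sub_pos x).ne']
  · have solitonPos_ne_zero (x : ℝ) : solitonPos c κ x ≠ 0 :=
      mul_ne_zero (Complex.ofReal_ne_zero.2 (sqrt_pos.2 (one_sub_pos x)).ne')
        (Complex.exp_ne_zero _)
    exact dense_univ.mono fun x _ ↦ solitonPos_ne_zero x

end SolitonPos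

theorem blackSoliton_im (κ x : ℝ) : (blackSoliton κ x).im = 0 := by
  unfold blackSoliton
  split_ifs <;> exact Complex.ofReal_im _

theorem norm_blackSoliton (κ x : ℝ) : ‖blackSoliton κ x‖ = √(1 - eta 0 κ x) := by
  unfold blackSoliton
  split_ifs <;> simp

section BlackSoliton

variable {κ : ℝ} (h : ((0 : ℝ), κ) ∈ D)
include h

theorem mem_D₁_union_D₂_of_zero_mem_D : ((0 : ℝ), κ) ∈ D₁ ∪ D₂ :=
  h.resolve_right fun h₃ ↦ (sqrt_nonneg 2).not_gt h₃.1

theorem admissible_of_zero_mem_D : Admissible 1 (1 - 2 * κ) κ := by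
  simpa using admissible_of_mem_D₁_union_D₂ (mem_D₁_union_D₂_of_zero_mem_D h)

theorem eta_zero_speed : eta 0 κ = profile 1 (1 - 2 * κ) κ := by
  simpa using eta_of_mem_D₁_union_D₂ (mem_D₁_union_D₂_of_zero_mem_D h)

theorem intensity_blackSoliton : intensity (blackSoliton κ) = eta 0 κ := by
  ext x
  have eta_le : eta 0 κ x ≤ 1 :=
    eta_zero_speed h ▸ ((admissible_of_zero_mem_D h).profile_mem x).2
  rw [intensity, norm_blackSoliton, sq_sqrt (sub_nonneg.2 eta_le), sub_sub_self]

theorem eta_zero_speed_lt_one {x : ℝ} (hx : x ≠ 0) : eta 0 κ x < 1 :=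
  eta_zero_speed h ▸ ((admissible_of_zero_mem_D h).profile_mem_Ioo hx).2

theorem blackSoliton_zero : blackSoliton κ 0 = 0 := by
  rw [← norm_eq_zero, norm_blackSoliton, eta_zero h]
  norm_num

theorem blackSoliton_neg (x : ℝ) : blackSoliton κ (-x) = -blackSoliton κ x := by
  rcases lt_trichotomy x 0 with hx | rfl | hx
  · simp [blackSoliton, hx.le, hx.not_ge, eta_neg]
  · simp [blackSoliton_zero h]
  · simp [blackSoliton, hx.le, hx.not_ge, eta_neg]

theorem coeff_eta_pos (x : ℝ) : 0 < 1 - 2 * κ + 2 * κ * eta 0 κ x :=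
  eta_zero_speed h ▸ (admissible_of_zero_mem_D h).coeff_profile_pos x

theorem hasDerivAt_blackSoliton_of_pos {x : ℝ} (hx : 0 < x) : HasDerivAt (blackSoliton κ)
    ((eta 0 κ x / √(2 * (1 - 2 * κ + 2 * κ * eta 0 κ x)) : ℝ) : ℂ) x := by
  have one_sub_pos : 0 < 1 - eta 0 κ x := sub_pos.2 (eta_zero_speed_lt_one h hx.ne')
  have coeff_pos := coeff_eta_pos h x
  have eta_deriv : HasDerivAt (eta 0 κ) (-(2 * √(1 - eta 0 κ x) *
      (eta 0 κ x / √(2 * (1 - 2 * κ + 2 * κ * eta 0 κ x))))) x := by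
    have hprofile := (admissible_of_zero_mem_D h).hasDerivAt_profile x
    rw [profileDeriv_of_pos hx, ← eta_zero_speed h, speed] at hprofile
    refine hprofile.congr_deriv ?_
    have hrate : rate 1 (1 - 2 * κ) κ (eta 0 κ x) =
        2 ^ 2 * (1 - eta 0 κ x) / (2 * (1 - 2 * κ + 2 * κ * eta 0 κ x)) := by
      rw [rate, div_eq_div_iff coeff_pos.ne' (by positivity)]
      ring
    rw [hrate, sqrt_div (by positivity), sqrt_mul (by positivity), sqrt_sq zero_le_two]
    ring
  have near : blackSoliton κ =ᶠ[𝓝 x] fun x ↦ ((√(1 - eta 0 κ x) : ℝ) : ℂ) := by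
    filter_upwards [eventually_gt_nhds hx] with y hy
    exact if_pos hy.le
  refine ((eta_deriv.const_sub 1).sqrt
    one_sub_pos.ne').ofReal_comp.congr_of_eventuallyEq near |>.congr_deriv ?_
  rw [neg_neg, mul_div_cancel_left₀ _ (by positivity)]

theorem contDiff_deriv_blackSoliton : ContDiff ℝ 1 fun x ↦
    ((eta 0 κ x / √(2 * (1 - 2 * κ + 2 * κ * eta 0 κ x)) : ℝ) : ℂ) := by
  have eta_contDiff : ContDiff ℝ 1 (eta 0 κ) := contDiff_infty.1 (contDiff_eta h) 1
  have coeff_pos (x : ℝ) : 0 < 2 * (1 - 2 * κ + 2 * κ * eta 0 κ x) :=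
    mul_pos two_pos (coeff_eta_pos h x)
  exact Complex.ofRealCLM.contDiff.comp (eta_contDiff.div
    (ContDiff.sqrt (by fun_prop) fun x ↦ (coeff_pos x).ne') fun x ↦ (sqrt_pos.2 (coeff_pos x)).ne')

theorem hasDerivAt_blackSoliton (x : ℝ) : HasDerivAt (blackSoliton κ)
    ((eta 0 κ x / √(2 * (1 - 2 * κ + 2 * κ * eta 0 κ x)) : ℝ) : ℂ) x := by
  have continuousAt_zero : ContinuousAt (blackSoliton κ) 0 := by
    have cont_eta := (contDiff_eta h).continuous
    have cont_norm : Continuous fun x ↦ ‖blackSoliton κ x‖ := by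
      simp only [norm_blackSoliton]
      fun_prop
    rw [ContinuousAt, blackSoliton_zero h]
    refine tendsto_zero_iff_norm_tendsto_zero.2 ?_
    simpa only [blackSoliton_zero h, norm_zero] using cont_norm.tendsto 0
  exact hasDerivAt_of_parity (ε := -1) (by simpa using blackSoliton_neg h) (by simp [eta_neg])
    continuousAt_zero (contDiff_deriv_blackSoliton h).continuous.continuousAt
    (fun y hy ↦ hasDerivAt_blackSoliton_of_pos h hy) x

theorem isSmoothSol_blackSoliton : IsSmoothSol 0 κ (blackSoliton κ) := by
  refine isSmoothSol_of_intensity_eq_eta h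
    (contDiff_two_of_hasDerivAt (hasDerivAt_blackSoliton h) (contDiff_deriv_blackSoliton h))
    (intensity_blackSoliton h) (fun x ↦ ?_) ((dense_compl_singleton 0).mono fun x hx ↦ ?_)
  · rw [current, (hasDerivAt_blackSoliton h x).deriv, Complex.im_mul_ofReal, Complex.conj_im,
      blackSoliton_im]
    ring
  · refine norm_ne_zero_iff.1 ?_
    rw [norm_blackSoliton]
    exact (sqrt_pos.2 (sub_pos.2 (eta_zero_speed_lt_one h hx))).ne'

end BlackSoliton

section Soliton

variable {c κ : ℝ} (h : (c, κ) ∈ D) (hc : 0 ≤ c)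
include h hc

theorem isSmoothSol_soliton : IsSmoothSol c κ (soliton c κ) := by
  rw [soliton]
  split_ifs with hc₀
  · subst hc₀
    exact isSmoothSol_blackSoliton h
  · exact isSmoothSol_solitonPos h (hc.lt_of_ne' hc₀)

theorem intensity_soliton : intensity (soliton c κ) = eta c κ := by
  rw [soliton]
  split_ifs with hc₀
  · subst hc₀
    exact intensity_blackSoliton h
  · exact intensity_solitonPos h (hc.lt_of_ne' hc₀)

theorem exists_isBigOToOrder_soliton : ∃ C > 0, ∀ n,
    IsBigOToOrder n (fun x ↦ exp (-C * |x|)) (deriv (soliton c κ)) ∧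
    IsBigOToOrder n (fun x ↦ exp (-C * |x|)) (eta c κ) :=
  (isSmoothSol_soliton h hc).exists_isBigOToOrder_deriv h (intensity_soliton h hc)

theorem contDiff_soliton : ContDiff ℝ (⊤ : ℕ∞) (soliton c κ) := by
  obtain ⟨C, -, hdecay⟩ := exists_isBigOToOrder_soliton h hc
  exact contDiff_infty_iff_deriv.2 ⟨(isSmoothSol_soliton h hc).1.differentiable two_ne_zero,
    contDiff_infty.2 fun n ↦ (hdecay n).1.1⟩

theorem exists_norm_iteratedDeriv_soliton_le : ∃ C : ℝ, 0 < C ∧ ∀ k : ℕ, ∃ A : ℝ, 0 < A ∧ ∀ x : ℝ,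
    ‖iteratedDeriv k (deriv (soliton c κ)) x‖ + |iteratedDeriv k (eta c κ) x| ≤
      A * exp (-C * |x|) := by
  obtain ⟨C, hC, hdecay⟩ := exists_isBigOToOrder_soliton h hc
  refine ⟨C, hC, fun k ↦ ?_⟩
  have hsum := ((hdecay k).1.2 k le_rfl).norm_left.add ((hdecay k).2.2 k le_rfl).norm_left
  obtain ⟨A, hA, hbound⟩ := hsum.exists_pos
  refine ⟨A, hA, fun x ↦ ?_⟩
  have hx := isBigOWith_top.1 hbound x
  rw [norm_of_nonneg (exp_pos _).le] at hx
  exact (le_abs_self _).trans hx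

end Soliton

end

end QGP

theorem theorem1p1 (c κ : ℝ) (hc : 0 ≤ c) :
    -- outside of `D` there are only trivial solutions
    ((c, κ) ∉ QGP.D → ∀ u : ℝ → ℂ, QGP.IsSmoothSol c κ u →
      ∃ φ : ℝ, ∀ x : ℝ, u x = Complex.exp ((φ : ℂ) * Complex.I)) ∧
    ((c, κ) ∈ QGP.D →
      -- the functions whose inverses define `η` are invertible
      ((c, κ) ∈ QGP.D₁ →
        Set.BijOn (QGP.funF c κ) (QGP.intervalI c) (Set.Ici 0)) ∧
      ((c, κ) ∈ QGP.D₂ →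
        Set.BijOn (QGP.funG c κ) (QGP.intervalI c) (Set.Ici 0)) ∧
      ((c, κ) ∈ QGP.D₃ →
        Set.BijOn (QGP.funH c κ) (QGP.intervalJ c) (Set.Ici 0)) ∧
      -- existence and uniqueness of the nontrivial solution
      (0 < c → (∀ x : ℝ, QGP.eta c κ x < 1) ∧
        QGP.IsUniqueNontrivialSol c κ (QGP.solitonPos c κ)) ∧
      (c = 0 → (∀ x : ℝ, (QGP.blackSoliton κ x).im = 0) ∧
        (∀ x : ℝ, QGP.blackSoliton κ (-x) = -QGP.blackSoliton κ x) ∧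
        QGP.IsUniqueNontrivialSol c κ (QGP.blackSoliton κ)) ∧
      -- smoothness
      ContDiff ℝ (⊤ : ℕ∞) (QGP.soliton c κ) ∧
      ContDiff ℝ (⊤ : ℕ∞) (QGP.eta c κ) ∧
      -- symmetry, extremum and monotonicity of the intensity profile
      (∀ x : ℝ, QGP.eta c κ (-x) = QGP.eta c κ x) ∧
      IsExtrOn (QGP.eta c κ) Set.univ 0 ∧
      QGP.eta c κ 0 = 1 - c ^ 2 / 2 ∧
      ((c, κ) ∈ QGP.D₁ ∪ QGP.D₂ → ∀ x : ℝ, 0 < x →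
        0 < QGP.eta c κ x ∧ deriv (QGP.eta c κ) x < 0) ∧
      ((c, κ) ∈ QGP.D₃ → ∀ x : ℝ, 0 < x →
        QGP.eta c κ x < 0 ∧ 0 < deriv (QGP.eta c κ) x) ∧
      -- exponential decay of all derivatives
      ∃ C : ℝ, 0 < C ∧ ∀ k : ℕ, ∃ A : ℝ, 0 < A ∧ ∀ x : ℝ,
        ‖iteratedDeriv k (deriv (QGP.soliton c κ)) x‖ + |iteratedDeriv k (QGP.eta c κ) x|
          ≤ A * Real.exp (-C * |x|)) := by
  refine ⟨fun hD u hu ↦ ?_, fun hD ↦ ⟨QGP.bijOn_funF, QGP.bijOn_funG, QGP.bijOn_funH,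
    fun hpos ↦ ⟨QGP.eta_lt_one hD hpos, ?_⟩, ?_, QGP.contDiff_soliton hD hc, QGP.contDiff_eta hD,
    QGP.eta_neg c κ, QGP.isExtrOn_eta hD, QGP.eta_zero hD,
    fun h x hx ↦ ⟨QGP.eta_pos h x, QGP.deriv_eta_lt_zero h hx⟩,
    fun h x hx ↦ ⟨QGP.eta_lt_zero h x, QGP.deriv_eta_pos h hx⟩,
    QGP.exists_norm_iteratedDeriv_soliton_le hD hc⟩⟩
  · exact by_contra fun nontrivial ↦ hD (hu.mem_D hc nontrivial)
  · exact (QGP.isSmoothSol_solitonPos hD hpos).isUniqueNontrivialSol hc hD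
      (QGP.intensity_solitonPos hD hpos)
  · rintro rfl
    exact ⟨QGP.blackSoliton_im κ, QGP.blackSoliton_neg hD,
      (QGP.isSmoothSol_blackSoliton hD).isUniqueNontrivialSol hc hD (QGP.intensity_blackSoliton hD)⟩
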